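/- Let $r\ge 1$ and $0\le k\le r-1$ be integers and let $t\in(-1,1)$. Write $\|f\|_2=\big(\int_{-1}^1|f(x)|^2\,dx\big)^{1/2}$ and $L_2=L_2([-1,1])$ (real-valued functions). For an interval $J$ and an integer $n\ge1$, let $L_2^n(J)$ be the space of functions $f:J\to\mathbb R$ such that $f^{(n-1)}$ is absolutely continuous on $J$ and $f^{(n)}\in L_2(J)$. Let $W_2^r=\{f\in L_2^r([-1,1]):\|f^{(r)}\|_2\le 1\}$. For $\delta>0$ put \[ \Omega_t(\delta)=\sup\{|f^{(k)}(t)|: f\in W_2^r,\ \|f\|_2\le\delta\} \] and, for a set $\mathscr R$ of mappings $S:L_2\to\mathbb R$, \[ \mathcal E_\delta(\mathscr R)=\inf_{S\in\mathscr R}\ \sup\{|f^{(k)}(t)-S(y)|: f\in W_2^r,\ y\in L_2,\ \|f-y\|_2\le\delta\}. \] For $\lambda\ge0$ consider the problem of finding $u\in L_2^{2r}((-1,t))\cap L_2^{2r}((t,1))$ such that \[ \begin{cases} (-1)^r u^{(2r)}(x)+\lambda u(x)=0, & x\in(-1,t)\cup(t,1),\\ u^{(s)}(-1)=u^{(s)}(1)=0,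 & s=0,1,\dots,r-1,\\ u^{(s)}(t+0)-u^{(s)}(t-0)=(-1)^{k-1}\delta_{r-k-1,s}, & s=0,1,\dots,2r-1, \end{cases} \] where $\delta_{i,j}$ is the Kronecker symbol and boundary values at $\pm1$ and at $t\pm0$ are one-sided limits. **Theorem.** For every $\lambda\ge0$ this problem has a solution $u_{\lambda,t}$, unique on $(-1,t)\cup(t,1)$. For every $\delta>0$ there exists a unique $\lambda=\lambda(\delta)>0$ such that $\delta\lambda\,\|u_{\lambda,t}\|_2=\|u_{\lambda,t}^{(r)}\|_2$ (where $u_{\lambda,t}^{(r)}$ is the derivative on $(-1,t)\cup(t,1)$), and for this $\lambda$, both when $\mathscr R$ is the set of all mappings $L_2\to\mathbb R$ and when $\mathscr R$ is the set of all linear functionals on $L_2$, \[ \Omega_t(\delta)=\mathcal E_\delta(\mathscr R)=\|u_{\lambda,t}^{(r)}\|_2\,\delta+\|u_{\lambda,t}\|_2 . \] -/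

import Mathlib

open Set Filter Topology MeasureTheory

noncomputable section

namespace LandauKolmogorov

/-- The norm `‖f‖₂ = (∫_{-1}^1 |f|²)^{1/2}` of `L₂(-1,1)`. -/
def l2norm (f : ℝ → ℝ) : ℝ := Real.sqrt (∫ x in (-1 : ℝ)..1, |f x| ^ 2)

/-- The Hilbert space `L₂ = L₂([-1,1])` of classes of square integrable functions. -/
abbrev L2 : Type := Lp ℝ 2 (volume.restrict (Icc (-1 : ℝ) 1))

/-- The space `L₂ⁿ([a,b])`, `n ≥ 1`, `a < b`: the derivative `f^{(n-1)}` exists and is absolutely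
continuous on `[a,b]`, and the (almost everywhere defined) derivative `f^{(n)}` is square
integrable. Derivatives at the endpoints are one-sided; only the values of `f` on `[a,b]` matter. -/
structure MemSobolev (n : ℕ) (a b : ℝ) (f : ℝ → ℝ) : Prop where
  contDiffOn : ContDiffOn ℝ ((n - 1 : ℕ) : WithTop ℕ∞) f (Icc a b)
  absolutelyContinuous :
    AbsolutelyContinuousOnInterval (iteratedDerivWithin (n - 1) f (Icc a b)) a b
  memLp : MemLp (iteratedDerivWithin n f (Icc a b)) 2 (volume.restrict (Icc a b))

/-- The space `L₂ⁿ((a,b))` over the open interval: as a function with absolutely continuous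
`(n-1)`-st derivative on the bounded interval `(a,b)` extends to `[a,b]`, this means that `f`
agrees on `(a,b)` with an element of `L₂ⁿ([a,b])`. -/
def MemSobolevOpen (n : ℕ) (a b : ℝ) (f : ℝ → ℝ) : Prop :=
  ∃ g : ℝ → ℝ, MemSobolev n a b g ∧ EqOn f g (Ioo a b)

/-- The class `W₂ʳ = {f ∈ L₂ʳ([-1,1]) : ‖f^{(r)}‖₂ ≤ 1}`. -/
def classW (r : ℕ) : Set (ℝ → ℝ) :=
  {f | MemSobolev r (-1) 1 f ∧ l2norm (iteratedDerivWithin r f (Icc (-1) 1)) ≤ 1}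

/-- The functional `D_t^k f = f^{(k)}(t)`, `t ∈ [-1,1]`. -/
def derivAt (k : ℕ) (t : ℝ) (f : ℝ → ℝ) : ℝ := iteratedDerivWithin k f (Icc (-1) 1) t

/-- The pointwise modulus of continuity
`Ω_t(δ) = sup {|f^{(k)}(t)| : f ∈ W₂ʳ, ‖f‖₂ ≤ δ}`, as an element of `[0,∞]`. -/
def modulus (r k : ℕ) (t δ : ℝ) : ENNReal :=
  ⨆ f ∈ {f : ℝ → ℝ | f ∈ classW r ∧ l2norm f ≤ δ}, ENNReal.ofReal |derivAt k t f|

/-- The error of recovery of `D_t^k` on `W₂ʳ` by the mapping `S`, from data given with error `δ`: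
`U_δ(S) = sup {|f^{(k)}(t) - S y| : f ∈ W₂ʳ, y ∈ L₂, ‖f - y‖₂ ≤ δ}`. -/
def recoveryErrorOf (r k : ℕ) (t δ : ℝ) (S : L2 → ℝ) : ENNReal :=
  ⨆ p ∈ {p : (ℝ → ℝ) × L2 | p.1 ∈ classW r ∧ l2norm (fun x => p.1 x - p.2 x) ≤ δ},
    ENNReal.ofReal |derivAt k t p.1 - S p.2|

/-- The error of optimal recovery `𝓔_δ(R; D_t^k; W₂ʳ) = inf {U_δ(S) : S ∈ R}`. -/
def optimalRecoveryError (R : Set (L2 → ℝ)) (r k : ℕ) (t δ : ℝ) : ENNReal :=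
  ⨅ S ∈ R, recoveryErrorOf r k t δ S

/-- `u` solves the boundary value problem
`(-1)^r u^{(2r)} + lam u = 0` on `(-1,t) ∪ (t,1)`,
`u^{(s)}(-1) = u^{(s)}(1) = 0` for `s < r`, and
`u^{(s)}(t+0) - u^{(s)}(t-0) = (-1)^{k-1} δ_{r-k-1,s}` for `s < 2r`
in `L₂^{2r}((-1,t)) ∩ L₂^{2r}((t,1))`. The sign is written `(-1)^(k+1)`; the values of `u` at the
three points `-1, t, 1` themselves are immaterial, boundary values being one-sided limits. -/
structure IsSolution (r k : ℕ) (t lam : ℝ) (u : ℝ → ℝ) : Prop where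
  left : MemSobolevOpen (2 * r) (-1) t u
  right : MemSobolevOpen (2 * r) t 1 u
  equation : ∀ x ∈ Ioo (-1) t ∪ Ioo t 1, (-1) ^ r * iteratedDeriv (2 * r) u x + lam * u x = 0
  boundary_left : ∀ s < r, Tendsto (iteratedDeriv s u) (𝓝[>] (-1)) (𝓝 0)
  boundary_right : ∀ s < r, Tendsto (iteratedDeriv s u) (𝓝[<] 1) (𝓝 0)
  jump : ∀ s < 2 * r, ∃ p q : ℝ, Tendsto (iteratedDeriv s u) (𝓝[>] t) (𝓝 p) ∧
    Tendsto (iteratedDeriv s u) (𝓝[<] t) (𝓝 q) ∧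
    p - q = if s = r - k - 1 then (-1) ^ (k + 1) else 0

end LandauKolmogorov

end

/-! Write `u` for the solution with parameter `λ`, and `U`, `D` for the classes of `u` and `u⁽ʳ⁾` in
`L₂`. Integrating by parts `r` times on each side of `t` kills the terms at `±1` and leaves only the
jump at `t`, so that `f⁽ᵏ⁾(t) = ⟨f, D⟩ - (-1)^r ⟨f⁽ʳ⁾, U⟩` (`derivAt_eq_inner`). Hence the linear
method `y ↦ ⟨y, D⟩` has error at most `δ‖D‖ + ‖U‖` for every `λ ≥ 0`, while no method beats the
modulus, since `f` and `-f` share the datum `y = 0`.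

The function `u⁽ʳ⁾` itself lies in the Sobolev space, because the jump has order below `r`, and its
`r`-th derivative is `-(-1)^r λ u`. It is therefore extremal in both Cauchy-Schwarz inequalities at
once; scaled by `1/(λ‖U‖)`, it has `r`-th derivative of norm `1` and norm `‖D‖/(λ‖U‖)`. The balance
equation says that the latter is `δ`, and the bounds meet (`le_modulus`).

For the balance equation, apply the representation with parameter `m` to the extremal function with
parameter `l`: `⟨D_l, D_m⟩ + l⟨U_l, U_m⟩` does not depend on `m` (`derivAt_extremal`). This identity
gives continuity in `λ > 0` and, with bounds from test polynomials, both signs of `δλ‖U‖ - ‖D‖`;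
hence existence (`exists_balance`). Two balanced parameters force equality in Cauchy-Schwarz, so
their solutions are proportional, and proportional nonzero solutions share `λ`
(`eq_of_solL2_eq_smul`).

Well-posedness is linear algebra: `2r` initial data at `t` against `2r` Dirichlet conditions, with
injectivity from the energy identity (`eq_zero_of_flow_dirichlet`). -/

namespace LandauKolmogorov

open scoped ContDiff

/-! ### Constant-coefficient linear equations through the matrix exponential. -/

section Flow

/-- The companion operator of the scalar equation `φ⁽ⁿ⁾ = c φ`. -/
noncomputable def companion (n : ℕ) (c : ℝ) : (Fin n → ℝ) →L[ℝ] (Fin n → ℝ) :=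
  ContinuousLinearMap.pi fun i =>
    if h : (i : ℕ) + 1 < n then ContinuousLinearMap.proj ⟨i + 1, h⟩
    else c • ContinuousLinearMap.proj ⟨0, i.pos⟩

theorem companion_apply (n : ℕ) (c : ℝ) (y : Fin n → ℝ) (i : Fin n) :
    companion n c y i = if h : (i : ℕ) + 1 < n then y ⟨i + 1, h⟩ else c * y ⟨0, i.pos⟩ := by
  unfold companion
  simp only [ContinuousLinearMap.coe_pi']
  split_ifs <;> simp

/-- The trajectory of `y' = companion n c y` with `y t = v`. -/
noncomputable def trajectory (n : ℕ) (c t : ℝ) (v : Fin n → ℝ) (x : ℝ) : Fin n → ℝ :=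
  NormedSpace.exp ((x - t) • companion n c) v

theorem hasDerivAt_trajectory (n : ℕ) (c t : ℝ) (v : Fin n → ℝ) (x : ℝ) :
    HasDerivAt (trajectory n c t v) (companion n c (trajectory n c t v x)) x := by
  have h1 := hasDerivAt_exp_smul_const' (𝕂 := ℝ) (companion n c) (x - t)
  have h2 := h1.comp_sub_const x t
  have h3 := h2.clm_apply (hasDerivAt_const x v)
  rw [map_zero, add_zero] at h3
  exact h3

@[simp]
theorem trajectory_self (n : ℕ) (c t : ℝ) (v : Fin n → ℝ) : trajectory n c t v t = v := by
  simp [trajectory]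

variable {n : ℕ} [NeZero n] {c t : ℝ}

/-- The solution of `φ⁽ⁿ⁾ = c φ` on `ℝ` with `φ⁽ⁱ⁾(t) = v i` for `i < n`. -/
noncomputable def flow (n : ℕ) [NeZero n] (c t : ℝ) (v : Fin n → ℝ) (x : ℝ) : ℝ :=
  trajectory n c t v x 0

theorem flow_add (v w : Fin n → ℝ) : flow n c t (v + w) = flow n c t v + flow n c t w := by
  ext x; simp [flow, trajectory]

theorem flow_smul (a : ℝ) (v : Fin n → ℝ) : flow n c t (a • v) = a • flow n c t v := by
  ext x; simp [flow, trajectory]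

/-- Each differentiation applies the companion operator once more. Being valid for every order, this
gives smoothness. -/
theorem iteratedDeriv_flow_eq (v : Fin n → ℝ) (m : ℕ) :
    iteratedDeriv m (flow n c t v) = fun x => (companion n c ^ m) (trajectory n c t v x) 0 := by
  induction m with
  | zero => ext x; simp [flow]
  | succ m ih =>
    ext x
    rw [iteratedDeriv_succ, ih]
    have h := ((companion n c ^ m).hasFDerivAt.comp_hasDerivAt x (hasDerivAt_trajectory n c t v x))
    have h' := (hasDerivAt_pi.1 h 0).deriv
    simp only [Function.comp_def] at h'
    rw [h', pow_succ]
    rfl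

theorem iteratedDeriv_flow (v : Fin n → ℝ) {m : ℕ} (hm : m < n) (x : ℝ) :
    iteratedDeriv m (flow n c t v) x = trajectory n c t v x ⟨m, hm⟩ := by
  induction m generalizing x with
  | zero => simp [flow]
  | succ m ih =>
    have hm' : m < n := by omega
    rw [iteratedDeriv_succ, show iteratedDeriv m (flow n c t v) = _ from funext (ih hm')]
    rw [(hasDerivAt_pi.1 (hasDerivAt_trajectory n c t v x) ⟨m, hm'⟩).deriv, companion_apply]
    simp [hm]

theorem iteratedDeriv_flow_self (v : Fin n → ℝ) {m : ℕ} (hm : m < n) :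
    iteratedDeriv m (flow n c t v) t = v ⟨m, hm⟩ := by
  rw [iteratedDeriv_flow v hm, trajectory_self]

theorem iteratedDeriv_order_flow (v : Fin n → ℝ) (x : ℝ) :
    iteratedDeriv n (flow n c t v) x = c * flow n c t v x := by
  obtain ⟨m, rfl⟩ : ∃ m, n = m + 1 := Nat.exists_eq_succ_of_ne_zero (NeZero.ne n)
  rw [iteratedDeriv_succ,
    show iteratedDeriv m (flow (m + 1) c t v) = _ from funext (iteratedDeriv_flow v m.lt_succ_self),
    (hasDerivAt_pi.1 (hasDerivAt_trajectory (m + 1) c t v x) ⟨m, m.lt_succ_self⟩).deriv,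
    companion_apply]
  simp [flow]

theorem contDiff_flow (v : Fin n → ℝ) : ContDiff ℝ ∞ (flow n c t v) := by
  refine contDiff_of_differentiable_iteratedDeriv fun m _ => ?_
  rw [iteratedDeriv_flow_eq]
  intro x
  have h := ((companion n c ^ m).hasFDerivAt.comp_hasDerivAt x (hasDerivAt_trajectory n c t v x))
  exact (hasDerivAt_pi.1 h 0).differentiableAt

end Flow

/-! ### Derivatives on a closed interval and integration by parts. -/

section Within

variable {a b : ℝ} {f g : ℝ → ℝ}

theorem iteratedDerivWithin_Icc_of_mem_Ioo (m : ℕ) (f : ℝ → ℝ) {x : ℝ} (hx : x ∈ Ioo a b) :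
    iteratedDerivWithin m f (Icc a b) x = iteratedDeriv m f x := by
  rw [← iteratedDerivWithin_univ, iteratedDerivWithin, iteratedDerivWithin, iteratedFDerivWithin_congr_set]
  exact eventuallyEq_univ.2 (Icc_mem_nhds hx.1 hx.2)


theorem deriv_iteratedDerivWithin_Icc (m : ℕ) (f : ℝ → ℝ) {x : ℝ} (hx : x ∈ Ioo a b) :
    deriv (iteratedDerivWithin m f (Icc a b)) x = iteratedDerivWithin (m + 1) f (Icc a b) x := by
  rw [iteratedDerivWithin_succ, derivWithin_of_mem_nhds (Icc_mem_nhds hx.1 hx.2)]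

theorem iteratedDerivWithin_Icc_eq_iteratedDeriv (hab : a < b) {f : ℝ → ℝ} {m : ℕ}
    (hf : ContDiff ℝ m f) {x : ℝ} (hx : x ∈ Icc a b) :
    iteratedDerivWithin m f (Icc a b) x = iteratedDeriv m f x :=
  iteratedDerivWithin_eq_iteratedDeriv (uniqueDiffOn_Icc hab) hf.contDiffAt hx

theorem MemSobolev.absolutelyContinuous_iteratedDerivWithin {n : ℕ} (hab : a < b)
    (hf : MemSobolev n a b f) {j : ℕ} (hj : j < n) :
    AbsolutelyContinuousOnInterval (iteratedDerivWithin j f (Icc a b)) a b := by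
  rcases Nat.lt_or_ge j (n - 1) with h | h
  · have h1 : ContDiffOn ℝ ((j + 1 : ℕ) : WithTop ℕ∞) f (Icc a b) :=
      hf.contDiffOn.of_le (by exact_mod_cast h)
    have h2 := ((contDiffOn_nat_succ_iff_contDiffOn_one_iteratedDerivWithin
      (uniqueDiffOn_Icc hab)).1 h1).2
    rw [← uIcc_of_le hab.le] at h2 ⊢
    exact h2.absolutelyContinuousOnInterval
  · obtain rfl : j = n - 1 := by omega
    exact hf.absolutelyContinuous

theorem contDiff_iteratedDeriv {f : ℝ → ℝ} (hf : ContDiff ℝ ∞ f) (m : ℕ) :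
    ContDiff ℝ ∞ (iteratedDeriv m f) := by
  rw [iteratedDeriv_eq_iterate]
  exact hf.iterate_deriv m

theorem _root_.ContDiff.natCast_of_top {f : ℝ → ℝ} (hf : ContDiff ℝ ∞ f) (m : ℕ) :
    ContDiff ℝ m f := hf.of_le (by exact_mod_cast le_top)

/-- A smooth function belongs to every Sobolev space. -/
theorem MemSobolev.of_contDiff (hab : a < b) (hf : ContDiff ℝ ∞ f) (n : ℕ) :
    MemSobolev n a b f := by
  have key : ∀ m : ℕ, EqOn (iteratedDerivWithin m f (Icc a b)) (iteratedDeriv m f) (Icc a b) :=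
    fun m x hx => iteratedDerivWithin_Icc_eq_iteratedDeriv hab (hf.natCast_of_top m) hx
  refine ⟨(hf.natCast_of_top _).contDiffOn, ?_, ?_⟩
  · have h : ContDiffOn ℝ ((n - 1 + 1 : ℕ) : WithTop ℕ∞) f (Icc a b) :=
      (hf.natCast_of_top _).contDiffOn
    have h2 := ((contDiffOn_nat_succ_iff_contDiffOn_one_iteratedDerivWithin
      (uniqueDiffOn_Icc hab)).1 h).2
    rw [← uIcc_of_le hab.le] at h2 ⊢
    exact h2.absolutelyContinuousOnInterval
  · have h : ContinuousOn (iteratedDerivWithin n f (Icc a b)) (Icc a b) :=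
      (((contDiff_iteratedDeriv hf n).continuous).continuousOn).congr (key n)
    obtain ⟨C, hC⟩ := isCompact_Icc.exists_bound_of_continuousOn h
    refine MemLp.of_bound (h.aestronglyMeasurable measurableSet_Icc) C ?_
    exact (ae_restrict_iff' measurableSet_Icc).2 (ae_of_all _ hC)

/-- Repeated integration by parts for a chain `F j` of absolutely continuous functions. -/
theorem integral_mul_eq_sum_add_integral (hab : a ≤ b) {r : ℕ} {F : ℕ → ℝ → ℝ} {φ : ℝ → ℝ}
    (hF : ∀ j < r, AbsolutelyContinuousOnInterval (F j) a b)
    (hF' : ∀ j < r, ∀ x ∈ Ioo a b, deriv (F j) x = F (j + 1) x) (hφ : ContDiff ℝ ∞ φ) :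
    ∫ x in a..b, F r x * φ x =
      ∑ s ∈ Finset.range r, (-1) ^ s *
        (F (r - 1 - s) b * iteratedDeriv s φ b - F (r - 1 - s) a * iteratedDeriv s φ a) +
      (-1) ^ r * ∫ x in a..b, F 0 x * iteratedDeriv r φ x := by
  have main : ∀ m ≤ r, ∫ x in a..b, F r x * φ x =
      ∑ s ∈ Finset.range m, (-1) ^ s *
        (F (r - 1 - s) b * iteratedDeriv s φ b - F (r - 1 - s) a * iteratedDeriv s φ a) +
      (-1) ^ m * ∫ x in a..b, F (r - m) x * iteratedDeriv m φ x := by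
    intro m hm
    induction m with
    | zero => simp
    | succ m ih =>
      rw [ih (by omega), Finset.sum_range_succ, add_assoc]
      congr 1
      have hj : r - m = (r - 1 - m) + 1 := by omega
      have hac : AbsolutelyContinuousOnInterval (iteratedDeriv m φ) a b :=
        (((contDiff_iteratedDeriv hφ m).of_le
          (by exact_mod_cast le_top)).contDiffOn).absolutelyContinuousOnInterval
      have hparts := (hF (r - 1 - m) (by omega)).integral_mul_deriv_eq_deriv_mul hac
      have hcongr : ∫ x in a..b, F (r - m) x * iteratedDeriv m φ x =
          ∫ x in a..b, deriv (F (r - 1 - m)) x * iteratedDeriv m φ x := by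
        refine intervalIntegral.integral_congr_ae ?_
        have : ∀ᵐ x : ℝ, x ≠ b := by simp [ae_iff, measure_singleton]
        filter_upwards [this] with x hxb hx
        rw [uIoc_of_le hab] at hx
        rw [hF' (r - 1 - m) (by omega) x ⟨hx.1, lt_of_le_of_ne hx.2 hxb⟩, ← hj]
      have hr : r - (m + 1) = r - 1 - m := by omega
      rw [hcongr, hr, iteratedDeriv_succ, hparts]
      ring
  simpa using main r le_rfl

end Within

/-! ### Sobolev solutions are classical solutions. -/

section Representation

variable {n : ℕ} [NeZero n] {a b c : ℝ}

/-- Run the flow from time `m` back to time `t`; the two exponentials are inverse to each other. -/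
theorem exists_trajectory_eq (n : ℕ) (c t m : ℝ) (w : Fin n → ℝ) :
    ∃ v, trajectory n c t v m = w := by
  refine ⟨trajectory n c m w t, ?_⟩
  let _ := NormedAlgebra.restrictScalars ℚ ℝ ((Fin n → ℝ) →L[ℝ] (Fin n → ℝ))
  unfold trajectory
  rw [← mul_apply_eq_comp, ← NormedSpace.exp_add_of_commute, ← add_smul]
  · simp
  · exact ((Commute.refl _).smul_left _).smul_right _

/-- A function in the Sobolev space satisfying `u⁽ⁿ⁾ = c u` on `(a,b)` is a restriction of a
solution on the whole line. -/
theorem MemSobolevOpen.exists_eqOn_flow (hab : a < b) {u : ℝ → ℝ} (hu : MemSobolevOpen n a b u)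
    (heq : ∀ x ∈ Ioo a b, iteratedDeriv n u x = c * u x) (t : ℝ) :
    ∃ v, EqOn u (flow n c t v) (Ioo a b) := by
  obtain ⟨g, hg, hug⟩ := hu
  have hn : n - 1 + 1 = n := Nat.succ_pred_eq_of_ne_zero (NeZero.ne n)
  have hgeq : ∀ x ∈ Ioo a b, iteratedDerivWithin n g (Icc a b) x = c * g x := by
    intro x hx
    have h : u =ᶠ[𝓝 x] g := by
      filter_upwards [isOpen_Ioo.mem_nhds hx] with z hz using hug hz
    rw [iteratedDerivWithin_Icc_of_mem_Ioo n g hx, ← h.iteratedDeriv_eq, heq x hx, hug hx]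
  have hgc : ContinuousOn g (Icc a b) := hg.contDiffOn.continuousOn
  set y : ℝ → Fin n → ℝ := fun x i => iteratedDerivWithin i g (Icc a b) x with hy
  -- Absolute continuity makes the top derivative the integral of `c * g`, which is continuous; so
  -- the equation, known only for values of `iteratedDerivWithin`, becomes a genuine derivative at
  -- every point.
  have hlast : ∀ x ∈ Ioo a b,
      HasDerivAt (iteratedDerivWithin (n - 1) g (Icc a b)) (c * g x) x := by
    intro x hx
    have hcg : ContinuousOn (fun x => c * g x) (Icc a b) := continuousOn_const.mul hgc
    have hder : HasDerivAt (fun z => iteratedDerivWithin (n - 1) g (Icc a b) a +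
        ∫ s in a..z, c * g s) (c * g x) x := by
      refine HasDerivAt.const_add _ (intervalIntegral.integral_hasDerivAt_right ?_ ?_ ?_)
      · refine (hcg.mono ?_).intervalIntegrable
        rw [uIcc_of_le hx.1.le]
        exact Icc_subset_Icc_right hx.2.le
      · exact (hcg.mono Ioo_subset_Icc_self).stronglyMeasurableAtFilter isOpen_Ioo x hx
      · exact hcg.continuousAt (Icc_mem_nhds hx.1 hx.2)
    refine hder.congr_of_eventuallyEq ?_
    filter_upwards [isOpen_Ioo.mem_nhds hx] with z hz
    have hac := hg.absolutelyContinuous.mono (c := a) (d := z)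
      (by rw [uIcc_of_le hz.1.le, uIcc_of_le hab.le]; exact Icc_subset_Icc_right hz.2.le)
    have hint : ∫ s in a..z, c * g s =
        ∫ s in a..z, deriv (iteratedDerivWithin (n - 1) g (Icc a b)) s := by
      refine intervalIntegral.integral_congr_ae (ae_of_all _ fun s hs => ?_)
      rw [uIoc_of_le hz.1.le] at hs
      have hs' : s ∈ Ioo a b := ⟨hs.1, hs.2.trans_lt hz.2⟩
      rw [deriv_iteratedDerivWithin_Icc _ _ hs', hn, hgeq s hs']
    rw [hint, hac.integral_deriv_eq_sub]
    ring
  have hy' : ∀ x ∈ Ioo a b, HasDerivAt y (companion n c (y x)) x := by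
    intro x hx
    rw [hasDerivAt_pi]
    intro i
    rw [companion_apply]
    split_ifs with h
    · have hd := (hg.contDiffOn.differentiableOn_iteratedDerivWithin (m := i)
        (by exact_mod_cast (by omega : (i : ℕ) < n - 1)) (uniqueDiffOn_Icc hab)).differentiableAt
          (Icc_mem_nhds hx.1 hx.2)
      have := hd.hasDerivAt
      rwa [deriv_iteratedDerivWithin_Icc _ _ hx] at this
    · have hi : (i : ℕ) = n - 1 := by have := i.isLt; omega
      simp only [hy, hi, iteratedDerivWithin_zero]
      exact hlast x hx
  obtain ⟨v, hv⟩ := exists_trajectory_eq n c t ((a + b) / 2) (y ((a + b) / 2))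
  refine ⟨v, fun x hx => ?_⟩
  have huniq := ODE_solution_unique_of_mem_Ioo (v := fun _ => companion n c) (s := fun _ => univ)
    (K := ‖companion n c‖₊) (f := y) (g := trajectory n c t v) (t₀ := (a + b) / 2)
    (fun _ _ => (companion n c).lipschitz.lipschitzOnWith)
    ⟨by linarith, by linarith⟩ (fun z hz => ⟨hy' z hz, mem_univ _⟩)
    (fun z _ => ⟨hasDerivAt_trajectory n c t v z, mem_univ _⟩) hv.symm
  have := congrFun (huniq hx) 0
  rw [hug hx]
  simpa [hy, flow] using this

end Representation

/-! ### Uniqueness for the Dirichlet problem by the energy identity. -/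

section Energy

variable {a b : ℝ}

theorem eqOn_zero_of_integral_sq_nonpos (hab : a < b) {f : ℝ → ℝ} (hf : Continuous f)
    (h : ∫ x in a..b, f x * f x ≤ 0) : EqOn f 0 (Icc a b) := by
  by_contra hne
  simp only [EqOn, not_forall] at hne
  obtain ⟨x, hx, hfx⟩ := hne
  have := intervalIntegral.integral_pos (f := fun x => f x * f x) hab
    (hf.mul hf).continuousOn (fun z _ => mul_self_nonneg _) ⟨x, hx, mul_self_pos.2 hfx⟩
  linarith

theorem eqOn_zero_of_iteratedDeriv {f : ℝ → ℝ} (hf : ContDiff ℝ ∞ f) {r : ℕ}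
    (ha : ∀ s < r, iteratedDeriv s f a = 0) (hr : EqOn (iteratedDeriv r f) 0 (Icc a b)) :
    EqOn f 0 (Icc a b) := by
  have key : ∀ j ≤ r, EqOn (iteratedDeriv (r - j) f) 0 (Icc a b) := by
    intro j hj
    induction j with
    | zero => simpa using hr
    | succ j ih =>
      intro x hx
      have hs : r - j = (r - (j + 1)) + 1 := by omega
      have hcd := contDiff_iteratedDeriv hf (r - (j + 1))
      have h1 : ∫ z in a..x, deriv (iteratedDeriv (r - (j + 1)) f) z =
          iteratedDeriv (r - (j + 1)) f x - iteratedDeriv (r - (j + 1)) f a :=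
        intervalIntegral.integral_deriv_eq_sub
          (fun z _ => (hcd.differentiable (by simp)).differentiableAt)
          ((hcd.continuous_deriv (by simp)).intervalIntegrable _ _)
      have h2 : ∫ z in a..x, deriv (iteratedDeriv (r - (j + 1)) f) z = ∫ z in a..x, (0 : ℝ) := by
        refine intervalIntegral.integral_congr fun z hz => ?_
        rw [uIcc_of_le hx.1] at hz
        have := ih (by omega) ⟨hz.1, hz.2.trans hx.2⟩
        rwa [hs, iteratedDeriv_succ] at this
      rw [h2, ha _ (by omega)] at h1
      simp only [intervalIntegral.integral_zero, sub_zero] at h1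
      exact h1.symm
  simpa using key r le_rfl

/-- The homogeneous Dirichlet problem for `(-1)^r φ⁽²ʳ⁾ + lam φ = 0` has only the zero solution. -/
theorem eq_zero_of_flow_dirichlet {r : ℕ} [NeZero r] {lam t : ℝ} (hlam : 0 ≤ lam)
    (ht : t ∈ Ioo a b) {v : Fin (2 * r) → ℝ}
    (ha : ∀ s < r, iteratedDeriv s (flow (2 * r) (-(-1) ^ r * lam) t v) a = 0)
    (hb : ∀ s < r, iteratedDeriv s (flow (2 * r) (-(-1) ^ r * lam) t v) b = 0) : v = 0 := by
  have hab : a < b := ht.1.trans ht.2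
  set φ := flow (2 * r) (-(-1) ^ r * lam) t v with hφdef
  have hφ : ContDiff ℝ ∞ φ := contDiff_flow v
  have hparts := integral_mul_eq_sum_add_integral hab.le (r := r)
    (F := fun j => iteratedDeriv (r + j) φ) (φ := φ)
    (fun j _ => ((contDiff_iteratedDeriv hφ (r + j)).of_le
      (by exact_mod_cast le_top)).contDiffOn.absolutelyContinuousOnInterval)
    (fun j _ x _ => by rw [← iteratedDeriv_succ]; rfl) hφ
  rw [Finset.sum_eq_zero (fun s hs => by
    rw [ha s (Finset.mem_range.1 hs), hb s (Finset.mem_range.1 hs)]; ring), zero_add] at hparts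
  have heq : ∀ x, iteratedDeriv (r + r) φ x = -(-1) ^ r * lam * φ x := by
    intro x; rw [← two_mul]; exact iteratedDeriv_order_flow v x
  have hsq : ((-1 : ℝ) ^ r) * (-1) ^ r = 1 := by rw [← mul_pow]; simp
  -- Energy identity: pairing the equation with `φ` gives `∫ (φ⁽ʳ⁾)² = -lam ∫ φ²`.
  have hle : ∫ x in a..b, iteratedDeriv r φ x * iteratedDeriv r φ x ≤ 0 := by
    have h1 : ∫ x in a..b, iteratedDeriv (r + r) φ x * φ x =
        -(-1) ^ r * lam * ∫ x in a..b, φ x * φ x := by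
      rw [← intervalIntegral.integral_const_mul]
      exact intervalIntegral.integral_congr fun x _ => by simp only [heq]; ring
    have h2 : 0 ≤ ∫ x in a..b, φ x * φ x :=
      intervalIntegral.integral_nonneg hab.le fun x _ => mul_self_nonneg _
    simp only [add_zero] at hparts
    rw [h1] at hparts
    have h3 : ∫ x in a..b, iteratedDeriv r φ x * iteratedDeriv r φ x =
        -(lam * ∫ x in a..b, φ x * φ x) := by
      linear_combination -(-1) ^ r * hparts - (lam * (∫ x in a..b, φ x * φ x) +
        ∫ x in a..b, iteratedDeriv r φ x * iteratedDeriv r φ x) * hsq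
    rw [h3]
    have := mul_nonneg hlam h2
    linarith
  have hzero : EqOn φ 0 (Icc a b) := eqOn_zero_of_iteratedDeriv hφ ha
    (eqOn_zero_of_integral_sq_nonpos hab (contDiff_iteratedDeriv hφ r).continuous hle)
  ext i
  have hev : φ =ᶠ[𝓝 t] fun _ => 0 := by
    filter_upwards [Icc_mem_nhds ht.1 ht.2] with x hx using hzero hx
  have h := hev.iteratedDeriv_eq (i : ℕ)
  rw [iteratedDeriv_flow_self v i.isLt] at h
  simpa using h

end Energy

/-! ### Well-posedness of the boundary value problem. -/

section BoundaryValueProblem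

variable {r k : ℕ} [NeZero r] {t lam : ℝ}

/-- The jump at `t` of the derivatives of the solution. -/
noncomputable def jumpVec (r k : ℕ) : Fin (2 * r) → ℝ :=
  fun s => if (s : ℕ) = r - k - 1 then (-1) ^ (k + 1) else 0

/-- The branch of a solution with derivatives `v` at `t`. -/
noncomputable abbrev branch (r : ℕ) [NeZero r] (t lam : ℝ) (v : Fin (2 * r) → ℝ) : ℝ → ℝ :=
  flow (2 * r) (-(-1) ^ r * lam) t v

/-- `v` are the derivatives at `t - 0` of a solution of the boundary value problem. -/
structure IsData (r k : ℕ) [NeZero r] (t lam : ℝ) (v : Fin (2 * r) → ℝ) : Prop where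
  left : ∀ s < r, iteratedDeriv s (branch r t lam v) (-1) = 0
  right : ∀ s < r, iteratedDeriv s (branch r t lam (v + jumpVec r k)) 1 = 0

theorem branch_add (v w : Fin (2 * r) → ℝ) (s : ℕ) (x : ℝ) :
    iteratedDeriv s (branch r t lam (v + w)) x =
      iteratedDeriv s (branch r t lam v) x + iteratedDeriv s (branch r t lam w) x := by
  rw [branch, flow_add, iteratedDeriv_add ((contDiff_flow v).natCast_of_top s).contDiffAt
    ((contDiff_flow w).natCast_of_top s).contDiffAt]

theorem branch_smul (a : ℝ) (w : Fin (2 * r) → ℝ) (s : ℕ) (x : ℝ) :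
    iteratedDeriv s (branch r t lam (a • w)) x = a * iteratedDeriv s (branch r t lam w) x := by
  rw [branch, flow_smul, iteratedDeriv_const_smul_field]
  rfl

/-- The Dirichlet values at `±1` of the branch with derivatives `v` at `t`. -/
noncomputable def dirichletMap (r : ℕ) [NeZero r] (t lam : ℝ) :
    (Fin (2 * r) → ℝ) →ₗ[ℝ] (Fin r → ℝ) × (Fin r → ℝ) where
  toFun v := (fun s => iteratedDeriv s (branch r t lam v) (-1),
    fun s => iteratedDeriv s (branch r t lam v) 1)
  map_add' v w := by ext s <;> simp [branch_add]
  map_smul' a v := by ext s <;> simp [branch_smul]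

theorem dirichletMap_injective (ht : t ∈ Ioo (-1 : ℝ) 1) (hlam : 0 ≤ lam) :
    Function.Injective (dirichletMap r t lam) := by
  rw [injective_iff_map_eq_zero]
  intro v hv
  rw [Prod.ext_iff] at hv
  exact eq_zero_of_flow_dirichlet hlam ht (fun s hs => congrFun hv.1 ⟨s, hs⟩)
    fun s hs => congrFun hv.2 ⟨s, hs⟩

theorem isData_iff {v : Fin (2 * r) → ℝ} : IsData r k t lam v ↔ dirichletMap r t lam v =
    (0, fun s : Fin r => -iteratedDeriv s (branch r t lam (jumpVec r k)) 1) := by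
  constructor
  · rintro ⟨h1, h2⟩
    refine Prod.ext (funext fun s => h1 s s.isLt) (funext fun s => ?_)
    have := h2 s s.isLt
    rw [branch_add] at this
    exact eq_neg_of_add_eq_zero_left this
  · intro h
    rw [Prod.ext_iff] at h
    refine ⟨fun s hs => congrFun h.1 ⟨s, hs⟩, fun s hs => ?_⟩
    rw [branch_add]
    have := congrFun h.2 ⟨s, hs⟩
    simp only [dirichletMap, LinearMap.coe_mk, AddHom.coe_mk] at this
    rw [this, neg_add_cancel]

/-- Moving the jump to the right-hand side leaves a square linear system, and injectivity implies
surjectivity. -/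
theorem exists_isData (k : ℕ) (ht : t ∈ Ioo (-1 : ℝ) 1) (hlam : 0 ≤ lam) :
    ∃ v, IsData r k t lam v := by
  simp only [isData_iff]
  have hfr : Module.finrank ℝ (Fin (2 * r) → ℝ) =
      Module.finrank ℝ ((Fin r → ℝ) × (Fin r → ℝ)) := by simp; ring
  exact (LinearMap.injective_iff_surjective_of_finrank_eq_finrank hfr).1
    (dirichletMap_injective ht hlam) _

theorem IsData.unique (ht : t ∈ Ioo (-1 : ℝ) 1) (hlam : 0 ≤ lam) {v w : Fin (2 * r) → ℝ}
    (hv : IsData r k t lam v) (hw : IsData r k t lam w) : v = w :=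
  dirichletMap_injective ht hlam ((isData_iff.1 hv).trans (isData_iff.1 hw).symm)

theorem iteratedDeriv_eqOn_of_eqOn {u φ : ℝ → ℝ} {a b : ℝ} (h : EqOn u φ (Ioo a b)) (s : ℕ) :
    EqOn (iteratedDeriv s u) (iteratedDeriv s φ) (Ioo a b) := by
  intro x hx
  have hev : u =ᶠ[𝓝 x] φ := by
    filter_upwards [isOpen_Ioo.mem_nhds hx] with z hz using h hz
  exact hev.iteratedDeriv_eq s

theorem tendsto_iteratedDeriv_right {u φ : ℝ → ℝ} {a b : ℝ} (hab : a < b)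
    (h : EqOn u φ (Ioo a b)) (hφ : ContDiff ℝ ∞ φ) (s : ℕ) :
    Tendsto (iteratedDeriv s u) (𝓝[>] a) (𝓝 (iteratedDeriv s φ a)) := by
  refine (((contDiff_iteratedDeriv hφ s).continuous.tendsto a).mono_left
    nhdsWithin_le_nhds).congr' ?_
  filter_upwards [Ioo_mem_nhdsGT hab] with x hx using (iteratedDeriv_eqOn_of_eqOn h s hx).symm

theorem tendsto_iteratedDeriv_left {u φ : ℝ → ℝ} {a b : ℝ} (hab : a < b)
    (h : EqOn u φ (Ioo a b)) (hφ : ContDiff ℝ ∞ φ) (s : ℕ) :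
    Tendsto (iteratedDeriv s u) (𝓝[<] b) (𝓝 (iteratedDeriv s φ b)) := by
  refine (((contDiff_iteratedDeriv hφ s).continuous.tendsto b).mono_left
    nhdsWithin_le_nhds).congr' ?_
  filter_upwards [Ioo_mem_nhdsLT hab] with x hx using (iteratedDeriv_eqOn_of_eqOn h s hx).symm

/-- Each half of a solution is a flow issued from `t`, so the jump conditions determine the right
data from the left. -/
theorem IsSolution.exists_isData {u : ℝ → ℝ} (ht : t ∈ Ioo (-1 : ℝ) 1)
    (hu : IsSolution r k t lam u) : ∃ v, IsData r k t lam v ∧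
      EqOn u (branch r t lam v) (Ioo (-1) t) ∧
      EqOn u (branch r t lam (v + jumpVec r k)) (Ioo t 1) := by
  have hsq : ((-1 : ℝ) ^ r) * (-1) ^ r = 1 := by rw [← mul_pow]; simp
  have heq : ∀ x ∈ Ioo (-1) t ∪ Ioo t 1,
      iteratedDeriv (2 * r) u x = -(-1) ^ r * lam * u x := by
    intro x hx
    have := hu.equation x hx
    linear_combination (-1) ^ r * this - iteratedDeriv (2 * r) u x * hsq
  obtain ⟨v, hv⟩ := hu.left.exists_eqOn_flow ht.1 (fun x hx => heq x (Or.inl hx)) t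
  obtain ⟨w, hw⟩ := hu.right.exists_eqOn_flow ht.2 (fun x hx => heq x (Or.inr hx)) t
  have hwv : w = v + jumpVec r k := by
    ext s
    obtain ⟨p, q, hp, hq, hpq⟩ := hu.jump s s.isLt
    have hp' := tendsto_nhds_unique hp (tendsto_iteratedDeriv_right ht.2 hw (contDiff_flow w) s)
    have hq' := tendsto_nhds_unique hq (tendsto_iteratedDeriv_left ht.1 hv (contDiff_flow v) s)
    rw [iteratedDeriv_flow_self _ s.isLt] at hp' hq'
    simp only [Fin.eta] at hp' hq'
    rw [Pi.add_apply, jumpVec, ← hpq, hp', hq']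
    ring
  subst hwv
  refine ⟨v, ⟨fun s hs => ?_, fun s hs => ?_⟩, hv, hw⟩
  · exact tendsto_nhds_unique (tendsto_iteratedDeriv_right ht.1 hv (contDiff_flow v) s)
      (hu.boundary_left s hs)
  · exact tendsto_nhds_unique (tendsto_iteratedDeriv_left ht.2 hw (contDiff_flow _) s)
      (hu.boundary_right s hs)

/-- The function equal to `φ` on the left of `t` and to `ψ` elsewhere. -/
noncomputable def glue (t : ℝ) (φ ψ : ℝ → ℝ) (x : ℝ) : ℝ := if x < t then φ x else ψ x

theorem glue_eqOn_left (a t : ℝ) (φ ψ : ℝ → ℝ) : EqOn (glue t φ ψ) φ (Ioo a t) :=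
  fun _ hx => if_pos hx.2

theorem glue_eqOn_right (t b : ℝ) (φ ψ : ℝ → ℝ) : EqOn (glue t φ ψ) ψ (Ioo t b) :=
  fun _ hx => if_neg (not_lt.2 hx.1.le)

theorem IsData.isSolution_glue (ht : t ∈ Ioo (-1 : ℝ) 1) {v : Fin (2 * r) → ℝ}
    (hv : IsData r k t lam v) : IsSolution r k t lam
      (glue t (branch r t lam v) (branch r t lam (v + jumpVec r k))) := by
  have hl := glue_eqOn_left (-1) t (branch r t lam v) (branch r t lam (v + jumpVec r k))
  have hr := glue_eqOn_right t 1 (branch r t lam v) (branch r t lam (v + jumpVec r k))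
  have hsq : ((-1 : ℝ) ^ r) * (-1) ^ r = 1 := by rw [← mul_pow]; simp
  refine ⟨⟨_, .of_contDiff ht.1 (contDiff_flow v) _, hl⟩, ⟨_, .of_contDiff ht.2
    (contDiff_flow _) _, hr⟩, ?_, fun s hs => ?_, fun s hs => ?_, fun s hs => ?_⟩
  · rintro x (hx | hx)
    · rw [iteratedDeriv_eqOn_of_eqOn hl _ hx, hl hx, iteratedDeriv_order_flow]
      linear_combination -lam * branch r t lam v x * hsq
    · rw [iteratedDeriv_eqOn_of_eqOn hr _ hx, hr hx, iteratedDeriv_order_flow]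
      linear_combination -lam * branch r t lam (v + jumpVec r k) x * hsq
  · rw [← hv.left s hs]
    exact tendsto_iteratedDeriv_right ht.1 hl (contDiff_flow _) s
  · rw [← hv.right s hs]
    exact tendsto_iteratedDeriv_left ht.2 hr (contDiff_flow _) s
  · refine ⟨_, _, tendsto_iteratedDeriv_right ht.2 hr (contDiff_flow _) s,
      tendsto_iteratedDeriv_left ht.1 hl (contDiff_flow _) s, ?_⟩
    rw [iteratedDeriv_flow_self _ hs, iteratedDeriv_flow_self _ hs]
    simp [jumpVec]

theorem existsUnique_isSolution (k : ℕ) (ht : t ∈ Ioo (-1 : ℝ) 1) (hlam : 0 ≤ lam) :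
    ∃ u, IsSolution r k t lam u ∧ ∀ v, IsSolution r k t lam v →
      EqOn v u (Ioo (-1) t ∪ Ioo t 1) := by
  obtain ⟨v, hv⟩ := exists_isData (r := r) k ht hlam
  refine ⟨_, hv.isSolution_glue ht, fun u hu => ?_⟩
  obtain ⟨w, hw, h1, h2⟩ := hu.exists_isData ht
  obtain rfl := hw.unique ht hlam hv
  rintro x (hx | hx)
  · rw [h1 hx, glue_eqOn_left (-1) t _ _ hx]
  · rw [h2 hx, glue_eqOn_right t 1 _ _ hx]

end BoundaryValueProblem

/-- Lebesgue measure on `[-1,1]`. -/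
noncomputable abbrev volI : Measure ℝ := volume.restrict (Icc (-1 : ℝ) 1)

/-! ### Integrals as inner products in `L₂`. -/

section L2

variable {f g : ℝ → ℝ} {F G : L2}

theorem intervalIntegral_eq_setIntegral_Icc (f : ℝ → ℝ) :
    ∫ x in (-1 : ℝ)..1, f x = ∫ x, f x ∂volI := by
  rw [intervalIntegral.integral_of_le (by norm_num), integral_Icc_eq_integral_Ioc]

theorem inner_eq_integral (hF : F =ᵐ[volI] f) (hG : G =ᵐ[volI] g) :
    inner ℝ F G = ∫ x in (-1 : ℝ)..1, f x * g x := by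
  rw [intervalIntegral_eq_setIntegral_Icc, L2.inner_def]
  refine integral_congr_ae ?_
  filter_upwards [hF, hG] with x hx hy
  rw [hx, hy]
  simp [mul_comm]

theorem intervalIntegrable_mul (hF : F =ᵐ[volI] f) (hG : G =ᵐ[volI] g) :
    IntervalIntegrable (fun x => f x * g x) volume (-1) 1 := by
  rw [intervalIntegrable_iff_integrableOn_Icc_of_le (by norm_num)]
  refine (L2.integrable_inner (𝕜 := ℝ) F G).congr ?_
  filter_upwards [hF, hG] with x hx hy
  rw [hx, hy]
  simp [mul_comm]

theorem l2norm_eq_norm (hF : F =ᵐ[volI] f) : l2norm f = ‖F‖ := by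
  rw [l2norm, norm_eq_sqrt_real_inner, inner_eq_integral hF hF]
  simp only [sq_abs, ← sq]

theorem memLp_of_continuousOn (hf : ContinuousOn f (Icc (-1) 1)) : MemLp f 2 volI := by
  obtain ⟨C, hC⟩ := isCompact_Icc.exists_bound_of_continuousOn hf
  exact MemLp.of_bound (hf.aestronglyMeasurable measurableSet_Icc) C
    ((ae_restrict_iff' measurableSet_Icc).2 (ae_of_all _ hC))

end L2

/-! ### Gluing two smooth functions at `t`. -/

section Glue

variable {t : ℝ} {φ ψ : ℝ → ℝ}

theorem memLp_glue (t : ℝ) (hφ : Continuous φ) (hψ : Continuous ψ) :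
    MemLp (glue t φ ψ) 2 volI := by
  have h1 : MemLp φ 2 volI := memLp_of_continuousOn hφ.continuousOn
  have h2 : MemLp ψ 2 volI := memLp_of_continuousOn hψ.continuousOn
  exact MemLp.piecewise (s := Iio t) measurableSet_Iio (h1.restrict _) (h2.restrict _)

theorem hasDerivAt_glue {φ' ψ' : ℝ → ℝ} (hφ : ∀ x, HasDerivAt φ (φ' x) x)
    (hψ : ∀ x, HasDerivAt ψ (ψ' x) x) (h0 : φ t = ψ t) {x : ℝ} (h1 : x = t → φ' t = ψ' t) :
    HasDerivAt (glue t φ ψ) (glue t φ' ψ' x) x := by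
  rcases lt_trichotomy x t with h | h | h
  · rw [glue, if_pos h]
    refine (hφ x).congr_of_eventuallyEq ?_
    filter_upwards [Iio_mem_nhds h] with z hz using if_pos hz
  · subst h
    rw [glue, if_neg (lt_irrefl _), ← hasDerivWithinAt_univ, ← Iic_union_Ici (a := x)]
    refine HasDerivWithinAt.union ?_ ?_
    · refine HasDerivWithinAt.congr (f := φ) ?_ (fun z hz => ?_) ?_
      · rw [← h1 rfl]; exact (hφ x).hasDerivWithinAt
      · rcases (show z ≤ x from hz).lt_or_eq with h | rfl
        · exact if_pos h
        · rw [glue, if_neg (lt_irrefl _), h0]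
      · rw [glue, if_neg (lt_irrefl _), h0]
    · exact (hψ x).hasDerivWithinAt.congr (fun z hz => if_neg (not_lt.2 hz))
        (if_neg (lt_irrefl _))
  · rw [glue, if_neg (not_lt.2 h.le)]
    refine (hψ x).congr_of_eventuallyEq ?_
    filter_upwards [Ioi_mem_nhds h] with z hz using if_neg (not_lt.2 (le_of_lt hz))

/-- The glued function is `φ (min x t) + ψ (max x t) - φ t`. It supplies absolute continuity of the
derivative of order `r - 1`, which may have a corner at `t`. -/
theorem locallyLipschitz_glue (hφ : ContDiff ℝ 1 φ) (hψ : ContDiff ℝ 1 ψ) (h0 : φ t = ψ t) :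
    LocallyLipschitz (glue t φ ψ) := by
  have h : glue t φ ψ = fun x => φ (min x t) + ψ (max x t) + -φ t := by
    ext x
    rcases lt_or_ge x t with h | h
    · rw [glue, if_pos h, min_eq_left h.le, max_eq_right h.le, h0]; ring
    · rw [glue, if_neg (not_lt.2 h), min_eq_right h, max_eq_left h]; ring
  rw [h]
  exact ((hφ.locallyLipschitz.comp (LocallyLipschitz.id.min_const t)).add
    (hψ.locallyLipschitz.comp (LocallyLipschitz.id.max_const t))).add (LocallyLipschitz.const _)

theorem hasDerivAt_iteratedDeriv (hφ : ContDiff ℝ ∞ φ) (s : ℕ) (x : ℝ) :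
    HasDerivAt (iteratedDeriv s φ) (iteratedDeriv (s + 1) φ x) x := by
  rw [iteratedDeriv_succ]
  exact ((contDiff_iteratedDeriv hφ s).differentiable (by simp)).differentiableAt.hasDerivAt

theorem iteratedDeriv_glue (hφ : ContDiff ℝ ∞ φ) (hψ : ContDiff ℝ ∞ ψ) {r : ℕ}
    (h : ∀ s < r, iteratedDeriv s φ t = iteratedDeriv s ψ t) {s : ℕ} (hs : s < r) :
    iteratedDeriv s (glue t φ ψ) = glue t (iteratedDeriv s φ) (iteratedDeriv s ψ) := by
  induction s with
  | zero => simp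
  | succ s ih =>
    ext x
    rw [iteratedDeriv_succ, ih (by omega)]
    exact (hasDerivAt_glue (hasDerivAt_iteratedDeriv hφ s) (hasDerivAt_iteratedDeriv hψ s)
      (h s (by omega)) fun _ => h (s + 1) hs).deriv

theorem iteratedDeriv_glue_of_ne (φ ψ : ℝ → ℝ) (s : ℕ) {x : ℝ} (hx : x ≠ t) :
    iteratedDeriv s (glue t φ ψ) x = glue t (iteratedDeriv s φ) (iteratedDeriv s ψ) x := by
  rcases hx.lt_or_gt with h | h
  · rw [iteratedDeriv_eqOn_of_eqOn (glue_eqOn_left (x - 1) t φ ψ) s ⟨by linarith, h⟩,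
      glue, if_pos h]
  · rw [iteratedDeriv_eqOn_of_eqOn (glue_eqOn_right t (x + 1) φ ψ) s ⟨h, by linarith⟩,
      glue, if_neg (not_lt.2 h.le)]

theorem ae_mem_Ioo_diff (t : ℝ) : ∀ᵐ x ∂volI, x ∈ Ioo (-1 : ℝ) 1 ∧ x ≠ t := by
  have h : ∀ y : ℝ, ∀ᵐ x ∂volI, x ≠ y := fun y =>
    ae_restrict_of_ae (by simp [ae_iff, measure_singleton])
  filter_upwards [h (-1), h 1, h t, ae_restrict_mem measurableSet_Icc] with x h1 h2 h3 h4
  exact ⟨⟨lt_of_le_of_ne h4.1 h1.symm, lt_of_le_of_ne h4.2 h2⟩, h3⟩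

variable {r : ℕ}

theorem iteratedDerivWithin_glue_ae (t : ℝ) (φ ψ : ℝ → ℝ) (s : ℕ) :
    iteratedDerivWithin s (glue t φ ψ) (Icc (-1) 1) =ᵐ[volI]
      glue t (iteratedDeriv s φ) (iteratedDeriv s ψ) := by
  filter_upwards [ae_mem_Ioo_diff t] with x hx
  rw [iteratedDerivWithin_Icc_of_mem_Ioo _ _ hx.1, iteratedDeriv_glue_of_ne φ ψ _ hx.2]

/-- Two smooth functions whose derivatives of order less than `r` agree at `t` are glued to an
element of the Sobolev space of order `r`. -/
theorem memSobolev_glue (hr : 0 < r) (hφ : ContDiff ℝ ∞ φ) (hψ : ContDiff ℝ ∞ ψ)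
    (h : ∀ s < r, iteratedDeriv s φ t = iteratedDeriv s ψ t) :
    MemSobolev r (-1) 1 (glue t φ ψ) := by
  have hlip : ∀ s < r, LocallyLipschitz (glue t (iteratedDeriv s φ) (iteratedDeriv s ψ)) :=
    fun s hs => locallyLipschitz_glue ((contDiff_iteratedDeriv hφ s).natCast_of_top 1)
      ((contDiff_iteratedDeriv hψ s).natCast_of_top 1) (h s hs)
  have hcd : ContDiff ℝ ((r - 1 : ℕ) : WithTop ℕ∞) (glue t φ ψ) := by
    refine contDiff_nat_iff_iteratedDeriv.2 ⟨fun m hm => ?_, fun m hm x => ?_⟩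
    · rw [iteratedDeriv_glue hφ hψ h (by omega)]
      exact (hlip m (by omega)).continuous
    · rw [iteratedDeriv_glue hφ hψ h (by omega)]
      exact (hasDerivAt_glue (hasDerivAt_iteratedDeriv hφ m) (hasDerivAt_iteratedDeriv hψ m)
        (h m (by omega)) fun _ => h (m + 1) (by omega)).differentiableAt
  refine ⟨hcd.contDiffOn, ?_, (memLp_congr_ae (iteratedDerivWithin_glue_ae t φ ψ r)).2
    (memLp_glue t (contDiff_iteratedDeriv hφ r).continuous (contDiff_iteratedDeriv hψ r).continuous)⟩
  obtain ⟨K, hK⟩ := ((hlip (r - 1) (by omega)).locallyLipschitzOn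
    (s := Icc (-1 : ℝ) 1)).exists_lipschitzOnWith_of_compact isCompact_Icc
  refine LipschitzOnWith.absolutelyContinuousOnInterval (K := K) ?_
  rw [uIcc_of_le (by norm_num)]
  intro x hx y hy
  have hEq : EqOn (iteratedDerivWithin (r - 1) (glue t φ ψ) (Icc (-1) 1))
      (glue t (iteratedDeriv (r - 1) φ) (iteratedDeriv (r - 1) ψ)) (Icc (-1) 1) := fun z hz => by
    rw [iteratedDerivWithin_Icc_eq_iteratedDeriv (by norm_num) hcd hz,
      iteratedDeriv_glue hφ hψ h (by omega)]
  rw [hEq hx, hEq hy]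
  exact hK hx hy

end Glue

/-! ### The representation of the derivative at `t`. -/

section Pairing

variable {r k : ℕ} [NeZero r] {t lam : ℝ}

/-- The class in `L₂` of the `s`-th derivative of the solution with derivatives `v` at `t - 0`. -/
noncomputable def solL2 (r k : ℕ) [NeZero r] (t lam : ℝ) (v : Fin (2 * r) → ℝ) (s : ℕ) : L2 :=
  (memLp_glue t (contDiff_iteratedDeriv (contDiff_flow v) s).continuous
    (contDiff_iteratedDeriv (contDiff_flow (v + jumpVec r k)) s).continuous).toLp
    (glue t (iteratedDeriv s (branch r t lam v)) (iteratedDeriv s (branch r t lam (v + jumpVec r k))))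

theorem solL2_ae (r k : ℕ) [NeZero r] (t lam : ℝ) (v : Fin (2 * r) → ℝ) (s : ℕ) :
    solL2 r k t lam v s =ᵐ[volI] glue t (iteratedDeriv s (branch r t lam v))
      (iteratedDeriv s (branch r t lam (v + jumpVec r k))) :=
  MemLp.coeFn_toLp _

theorem inner_solL2 (ht : t ∈ Ioo (-1 : ℝ) 1) (v : Fin (2 * r) → ℝ) (s : ℕ) {f : ℝ → ℝ} {F : L2}
    (hF : F =ᵐ[volI] f) : inner ℝ F (solL2 r k t lam v s) =
      (∫ x in (-1)..t, f x * iteratedDeriv s (branch r t lam v) x) +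
        ∫ x in t..1, f x * iteratedDeriv s (branch r t lam (v + jumpVec r k)) x := by
  have hint := intervalIntegrable_mul hF (solL2_ae r k t lam v s)
  rw [inner_eq_integral hF (solL2_ae r k t lam v s),
    ← intervalIntegral.integral_add_adjacent_intervals (b := t)
      (hint.mono_set (by rw [uIcc_of_le ht.1.le, uIcc_of_le (by norm_num)]
                         exact Icc_subset_Icc_right ht.2.le))
      (hint.mono_set (by rw [uIcc_of_le ht.2.le, uIcc_of_le (by norm_num)]
                         exact Icc_subset_Icc_left ht.1.le))]
  congr 1
  · refine intervalIntegral.integral_congr_ae ?_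
    have : ∀ᵐ x : ℝ, x ≠ t := by simp [ae_iff, measure_singleton]
    filter_upwards [this] with x hxt hx
    rw [uIoc_of_le ht.1.le] at hx
    rw [glue, if_pos (lt_of_le_of_ne hx.2 hxt)]
  · refine intervalIntegral.integral_congr_ae (ae_of_all _ fun x hx => ?_)
    rw [uIoc_of_le ht.2.le] at hx
    rw [glue, if_neg (not_lt.2 hx.1.le)]

/-- The representation `f⁽ᵏ⁾(t) = ⟨f, u⁽ʳ⁾⟩ - (-1)^r ⟨f⁽ʳ⁾, u⟩`. -/
theorem derivAt_eq_inner (hk : k < r) (ht : t ∈ Ioo (-1 : ℝ) 1) {v : Fin (2 * r) → ℝ}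
    (hv : IsData r k t lam v) {f : ℝ → ℝ} (hf : MemSobolev r (-1) 1 f) {F G : L2}
    (hF : F =ᵐ[volI] f) (hG : G =ᵐ[volI] iteratedDerivWithin r f (Icc (-1) 1)) :
    derivAt k t f = inner ℝ F (solL2 r k t lam v r) -
      (-1) ^ r * inner ℝ G (solL2 r k t lam v 0) := by
  have hac : ∀ {a b : ℝ}, -1 ≤ a → a ≤ b → b ≤ 1 → ∀ j < r,
      AbsolutelyContinuousOnInterval (iteratedDerivWithin j f (Icc (-1) 1)) a b := by
    intro a b ha hab hb j hj
    refine (hf.absolutelyContinuous_iteratedDerivWithin (by norm_num) hj).mono ?_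
    rw [uIcc_of_le hab, uIcc_of_le (by norm_num)]
    exact Icc_subset_Icc ha hb
  have hl := integral_mul_eq_sum_add_integral ht.1.le (hac le_rfl ht.1.le ht.2.le)
    (fun j _ x hx => deriv_iteratedDerivWithin_Icc j f ⟨hx.1, hx.2.trans ht.2⟩)
    (contDiff_flow (n := 2 * r) (c := -(-1) ^ r * lam) (t := t) v)
  have hr := integral_mul_eq_sum_add_integral ht.2.le (hac ht.1.le ht.2.le le_rfl)
    (fun j _ x hx => deriv_iteratedDerivWithin_Icc j f ⟨ht.1.trans hx.1, hx.2⟩)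
    (contDiff_flow (n := 2 * r) (c := -(-1) ^ r * lam) (t := t) (v + jumpVec r k))
  rw [inner_solL2 ht v r hF, inner_solL2 ht v 0 hG]
  simp only [iteratedDeriv_zero, iteratedDerivWithin_zero] at hl hr ⊢
  rw [hl, hr]
  -- Dirichlet conditions remove the terms at `±1`; at `t` the two sides cancel except for `s = r -
  -- k - 1`, whose partner is the derivative of `f` of order `k`.
  have hsum : (∑ s ∈ Finset.range r, (-1 : ℝ) ^ s *
        (iteratedDerivWithin (r - 1 - s) f (Icc (-1) 1) t * iteratedDeriv s (branch r t lam v) t -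
          iteratedDerivWithin (r - 1 - s) f (Icc (-1) 1) (-1) *
            iteratedDeriv s (branch r t lam v) (-1))) +
      (∑ s ∈ Finset.range r, (-1 : ℝ) ^ s *
        (iteratedDerivWithin (r - 1 - s) f (Icc (-1) 1) 1 *
            iteratedDeriv s (branch r t lam (v + jumpVec r k)) 1 -
          iteratedDerivWithin (r - 1 - s) f (Icc (-1) 1) t *
            iteratedDeriv s (branch r t lam (v + jumpVec r k)) t)) =
      -(-1) ^ r * derivAt k t f := by
    rw [← Finset.sum_add_distrib, Finset.sum_eq_single_of_mem (r - k - 1)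
      (Finset.mem_range.2 (by omega))]
    · rw [hv.left _ (by omega), hv.right _ (by omega), iteratedDeriv_flow_self _ (by omega),
        iteratedDeriv_flow_self _ (by omega), show r - 1 - (r - k - 1) = k by omega, derivAt]
      -- The sign of the jump is chosen so that the surviving coefficient is `-(-1)^r`, whatever `k`
      -- is.
      have hp : (-1 : ℝ) ^ r = (-1) ^ (r - k - 1) * (-1) ^ (k + 1) := by
        rw [← pow_add]; congr 1; omega
      rw [hp]
      simp [jumpVec]
      ring
    · intro s hs hne
      have hs' := Finset.mem_range.1 hs
      rw [hv.left _ hs', hv.right _ hs', iteratedDeriv_flow_self _ (by omega),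
        iteratedDeriv_flow_self _ (by omega)]
      simp [jumpVec, hne]
  have hsq : ((-1 : ℝ) ^ r) * (-1) ^ r = 1 := by rw [← mul_pow]; simp
  unfold branch at *
  linear_combination (-1) ^ r * hsum +
    ((∫ x in (-1)..t, f x * iteratedDeriv r (flow (2 * r) (-(-1) ^ r * lam) t v) x) +
      (∫ x in t..1, f x * iteratedDeriv r (flow (2 * r) (-(-1) ^ r * lam) t (v + jumpVec r k)) x) -
      derivAt k t f) * hsq

end Pairing

/-! ### The balance equation in an abstract Hilbert space setting. -/

section Balance

variable {H : Type*} [NormedAddCommGroup H] [InnerProductSpace ℝ H] {U D : ℝ → H} {φ : ℝ → ℝ}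

/-- Expand the squares and use the identity at all four pairs from `l`, `m`. The factor `m - l` on
the right is what gives continuity. -/
theorem sq_add_mul_sq_eq_of_reproducing
    (hφ : ∀ l m, 0 ≤ l → 0 ≤ m → inner ℝ (D l) (D m) + l * inner ℝ (U l) (U m) = φ l)
    {l m : ℝ} (hl : 0 ≤ l) (hm : 0 ≤ m) :
    ‖D l - D m‖ ^ 2 + l * ‖U l - U m‖ ^ 2 = (m - l) * inner ℝ (U l - U m) (U m) := by
  have h1 := hφ l m hl hm
  have h2 := hφ m l hm hl
  have h3 := hφ l l hl hl
  have h4 := hφ m m hm hm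
  rw [real_inner_comm (D l), real_inner_comm (U l)] at h2
  rw [real_inner_self_eq_norm_sq, real_inner_self_eq_norm_sq] at h3 h4
  rw [norm_sub_sq_real, norm_sub_sq_real, inner_sub_left, real_inner_self_eq_norm_sq]
  linear_combination h3 - 2 * h1 + h4 - h2 + h1

theorem tendsto_of_reproducing
    (hφ : ∀ l m, 0 ≤ l → 0 ≤ m → inner ℝ (D l) (D m) + l * inner ℝ (U l) (U m) = φ l)
    {m : ℝ} (hm : 0 < m) : Tendsto U (𝓝 m) (𝓝 (U m)) ∧ Tendsto D (𝓝 m) (𝓝 (D m)) := by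
  have hev : ∀ᶠ l in 𝓝 m, m / 2 < l := lt_mem_nhds (by linarith)
  have key : ∀ l, m / 2 < l → ‖U l - U m‖ ≤ 2 * |m - l| * ‖U m‖ / m ∧
      ‖D l - D m‖ ≤ √(|m - l| * (2 * |m - l| * ‖U m‖ / m) * ‖U m‖) := by
    intro l hl
    have hl0 : 0 < l := by linarith
    have h := sq_add_mul_sq_eq_of_reproducing hφ hl0.le hm.le
    have hle : (m - l) * inner ℝ (U l - U m) (U m) ≤ |m - l| * (‖U l - U m‖ * ‖U m‖) := by
      refine (le_abs_self _).trans ?_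
      rw [abs_mul]
      exact mul_le_mul_of_nonneg_left (abs_real_inner_le_norm _ _) (abs_nonneg _)
    have hU : ‖U l - U m‖ ≤ 2 * |m - l| * ‖U m‖ / m := by
      rcases (norm_nonneg (U l - U m)).eq_or_lt with h0 | h0
      · rw [← h0]; positivity
      · rw [le_div_iff₀ hm]
        have h1 : l * ‖U l - U m‖ ≤ |m - l| * ‖U m‖ := by
          refine le_of_mul_le_mul_right ?_ h0
          nlinarith [sq_nonneg ‖D l - D m‖]
        nlinarith
    refine ⟨hU, Real.le_sqrt_of_sq_le ?_⟩
    have h2 : |m - l| * (‖U l - U m‖ * ‖U m‖) ≤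
        |m - l| * (2 * |m - l| * ‖U m‖ / m) * ‖U m‖ := by
      rw [← mul_assoc]; gcongr
    have h3 : 0 ≤ l * ‖U l - U m‖ ^ 2 := by positivity
    linarith
  constructor
  · rw [tendsto_iff_norm_sub_tendsto_zero]
    refine squeeze_zero' (.of_forall fun _ => norm_nonneg _)
      (hev.mono fun l hl => (key l hl).1) ?_
    exact Continuous.tendsto' (by fun_prop) _ _ (by simp)
  · rw [tendsto_iff_norm_sub_tendsto_zero]
    refine squeeze_zero' (.of_forall fun _ => norm_nonneg _)
      (hev.mono fun l hl => (key l hl).2) ?_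
    exact Continuous.tendsto' (by fun_prop) _ _ (by simp)

/-- Comparison with the parameter `0`: the identity at `(l, 0)`, with `⟨D 0, D l⟩ = ‖D 0‖ ^ 2` from
the pair `(0, l)`. -/
theorem le_add_mul_of_reproducing
    (hφ : ∀ l m, 0 ≤ l → 0 ≤ m → inner ℝ (D l) (D m) + l * inner ℝ (U l) (U m) = φ l)
    {l : ℝ} (hl : 0 ≤ l) : ‖D l‖ ^ 2 + l * ‖U l‖ ^ 2 ≤ ‖D 0‖ ^ 2 + l * ‖U l‖ * ‖U 0‖ := by
  have h1 := hφ l 0 hl le_rfl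
  have h2 := hφ 0 l le_rfl hl
  have h3 := hφ l l hl hl
  have h4 := hφ 0 0 le_rfl le_rfl
  rw [real_inner_comm (D l), zero_mul, add_zero] at h2
  rw [real_inner_self_eq_norm_sq] at h3 h4
  rw [real_inner_self_eq_norm_sq] at h3
  have h5 := mul_le_mul_of_nonneg_left (real_inner_le_norm (U l) (U 0)) hl
  linarith

/-- For small `l`: were the inequality false, `x = l‖U l‖` would be at least `c / δ`, whereas
comparison with the parameter `0` gives `x ≤ l K`. -/
theorem exists_lt_balance
    (hφ : ∀ l m, 0 ≤ l → 0 ≤ m → inner ℝ (D l) (D m) + l * inner ℝ (U l) (U m) = φ l)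
    {c : ℝ} (hc : 0 < c) (hcD : ∀ l, 0 ≤ l → c ≤ ‖D l‖) {δ : ℝ} (hδ : 0 < δ) :
    ∃ l, 0 < l ∧ δ * l * ‖U l‖ < ‖D l‖ := by
  set c' := c / δ with hc'
  have hc'0 : 0 < c' := by positivity
  set K := ‖D 0‖ ^ 2 / c' + ‖U 0‖ with hK
  have hK0 : 0 ≤ K := by positivity
  set l := c' / (2 * (K + 1)) with hl
  have hl0 : 0 < l := by positivity
  have hlK : l * (2 * (K + 1)) = c' := by rw [hl]; field_simp
  refine ⟨l, hl0, ?_⟩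
  by_contra! hcon
  have hx : c' ≤ l * ‖U l‖ := by
    rw [hc', div_le_iff₀ hδ]
    have := hcD l hl0.le
    nlinarith
  set x := l * ‖U l‖ with hxdef
  have hx0 : 0 < x := hc'0.trans_le hx
  have h1 := le_add_mul_of_reproducing hφ hl0.le
  have h2 : x ^ 2 ≤ l * (‖D 0‖ ^ 2 + x * ‖U 0‖) := by
    have : x ^ 2 = l * (l * ‖U l‖ ^ 2) := by rw [hxdef]; ring
    rw [this]
    refine mul_le_mul_of_nonneg_left ?_ hl0.le
    nlinarith [sq_nonneg ‖D l‖]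
  have h3 : ‖D 0‖ ^ 2 ≤ ‖D 0‖ ^ 2 / c' * x := by
    rw [div_mul_eq_mul_div, le_div_iff₀ hc'0]
    exact mul_le_mul_of_nonneg_left hx (sq_nonneg _)
  have h4 : x ^ 2 ≤ l * K * x := by
    calc x ^ 2 ≤ l * (‖D 0‖ ^ 2 + x * ‖U 0‖) := h2
      _ ≤ l * (‖D 0‖ ^ 2 / c' * x + x * ‖U 0‖) := by gcongr
      _ = l * K * x := by rw [hK]; ring
  have h5 : x ≤ l * K := by nlinarith
  nlinarith

/-- For large `l`: were the inequality always false, `‖D l‖` would stay bounded and `‖U l‖` would be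
`O(1/l)`, contradicting `htest` for small `ε`. -/
theorem exists_gt_balance
    (hφ : ∀ l m, 0 ≤ l → 0 ≤ m → inner ℝ (D l) (D m) + l * inner ℝ (U l) (U m) = φ l)
    (htest : ∀ ε, 0 < ε → ∃ M, ∀ l, 0 ≤ l → 1 ≤ ε * ‖D l‖ + M * ‖U l‖) {δ : ℝ} (hδ : 0 < δ) :
    ∃ l, 0 < l ∧ ‖D l‖ < δ * l * ‖U l‖ := by
  by_contra! hcon
  set K := ‖U 0‖ / δ with hK
  have hK0 : 0 ≤ K := by positivity
  -- The bound comes from `‖D l‖ ^ 2 ≤ ‖D 0‖ ^ 2 + K * ‖D l‖`; the summand `1` ensures `‖D l‖ > 1`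
  -- whenever `‖D l‖ > B`.
  set B := ‖D 0‖ ^ 2 + K + 1 with hB
  have hB0 : 0 < B := by positivity
  have hDB : ∀ l, 0 < l → ‖D l‖ ≤ B := by
    intro l hl
    have h1 := le_add_mul_of_reproducing hφ hl.le
    have h2 : l * ‖U l‖ * ‖U 0‖ ≤ K * ‖D l‖ := by
      rw [hK, div_mul_eq_mul_div, le_div_iff₀ hδ]
      have := mul_le_mul_of_nonneg_right (hcon l hl) (norm_nonneg (U 0))
      linarith
    have h3 : 0 ≤ l * ‖U l‖ ^ 2 := by positivity
    by_contra! h4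
    have h5 : 0 ≤ ‖D 0‖ ^ 2 := sq_nonneg _
    have h6 : 1 < ‖D l‖ := by linarith
    nlinarith
  obtain ⟨M, hM⟩ := htest (1 / (2 * B)) (by positivity)
  set l := 2 * (|M| + 1) * B / δ with hl
  have hl0 : 0 < l := by positivity
  have h1 := hM l hl0.le
  have h2 : 1 / (2 * B) * ‖D l‖ ≤ 1 / 2 := by
    rw [div_mul_eq_mul_div, one_mul, div_le_div_iff₀ (by positivity) (by norm_num)]
    linarith [hDB l hl0]
  have h3 := (hcon l hl0).trans (hDB l hl0)
  have h4 : δ * l = 2 * (|M| + 1) * B := by rw [hl]; field_simp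
  rw [h4] at h3
  have h5 : 2 * (|M| + 1) * ‖U l‖ ≤ 1 := by
    refine le_of_mul_le_mul_right ?_ hB0
    linarith
  have h6 : M * ‖U l‖ ≤ |M| * ‖U l‖ := mul_le_mul_of_nonneg_right (le_abs_self M) (norm_nonneg _)
  have h7 : ‖U l‖ ≤ 0 := by nlinarith
  have h8 : ‖U l‖ = 0 := le_antisymm h7 (norm_nonneg _)
  rw [h8] at h1
  linarith

theorem exists_balance
    (hφ : ∀ l m, 0 ≤ l → 0 ≤ m → inner ℝ (D l) (D m) + l * inner ℝ (U l) (U m) = φ l)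
    {c : ℝ} (hc : 0 < c) (hcD : ∀ l, 0 ≤ l → c ≤ ‖D l‖)
    (htest : ∀ ε, 0 < ε → ∃ M, ∀ l, 0 ≤ l → 1 ≤ ε * ‖D l‖ + M * ‖U l‖) {δ : ℝ} (hδ : 0 < δ) :
    ∃ l, 0 < l ∧ δ * l * ‖U l‖ = ‖D l‖ := by
  obtain ⟨l₁, hl₁, h₁⟩ := exists_lt_balance hφ hc hcD hδ
  obtain ⟨l₂, hl₂, h₂⟩ := exists_gt_balance hφ htest hδ
  have hcont : ContinuousOn (fun l => δ * l * ‖U l‖ - ‖D l‖) (Ioi 0) := by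
    intro m hm
    obtain ⟨hU, hD⟩ := tendsto_of_reproducing hφ hm
    have : ContinuousAt (fun l => δ * l * ‖U l‖ - ‖D l‖) m :=
      ((continuousAt_const.mul continuousAt_id).mul hU.norm).sub hD.norm
    exact this.continuousWithinAt
  obtain ⟨l, hl, h⟩ := isPreconnected_Ioi.intermediate_value hl₁ hl₂ hcont
    (⟨by linarith, by linarith⟩ : (0 : ℝ) ∈ Icc _ _)
  exact ⟨l, hl, sub_eq_zero.1 h⟩

/-- Bounding both inner products by Cauchy-Schwarz gives `a(1 + δ²l) ≤ b(1 + δ²m)` for `a = ‖U l‖`,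
`b = ‖U m‖`, and by symmetry the reverse; so Cauchy-Schwarz is an equality. -/
theorem smul_eq_smul_of_balance
    (hφ : ∀ l m, 0 ≤ l → 0 ≤ m → inner ℝ (D l) (D m) + l * inner ℝ (U l) (U m) = φ l)
    {δ l m : ℝ} (hl : 0 < l) (hm : 0 < m) (hUl : U l ≠ 0) (hUm : U m ≠ 0)
    (h₁ : δ * l * ‖U l‖ = ‖D l‖) (h₂ : δ * m * ‖U m‖ = ‖D m‖) :
    ‖U m‖ • U l = ‖U l‖ • U m := by
  rw [← inner_eq_norm_mul_iff_real]
  have e1 := hφ l m hl.le hm.le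
  have e2 := hφ m l hm.le hl.le
  have e3 := hφ l l hl.le hl.le
  have e4 := hφ m m hm.le hm.le
  rw [real_inner_comm (D l), real_inner_comm (U l)] at e2
  rw [real_inner_self_eq_norm_sq, real_inner_self_eq_norm_sq] at e3 e4
  have hp := real_inner_le_norm (D l) (D m)
  have hq := real_inner_le_norm (U l) (U m)
  have ha : 0 < ‖U l‖ := norm_pos_iff.2 hUl
  have hb : 0 < ‖U m‖ := norm_pos_iff.2 hUm
  rw [← h₁, ← h₂] at hp
  rw [← h₁] at e3
  rw [← h₂] at e4
  set a := ‖U l‖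
  set b := ‖U m‖
  set p := inner ℝ (D l) (D m)
  set q := inner ℝ (U l) (U m)
  have i1 : a * (1 + δ ^ 2 * l) ≤ b * (1 + δ ^ 2 * m) := by
    refine le_of_mul_le_mul_left ?_ (mul_pos hl ha)
    have := mul_le_mul_of_nonneg_left hq hl.le
    nlinarith
  have i2 : b * (1 + δ ^ 2 * m) ≤ a * (1 + δ ^ 2 * l) := by
    refine le_of_mul_le_mul_left ?_ (mul_pos hm hb)
    have := mul_le_mul_of_nonneg_left hq hm.le
    nlinarith
  refine le_antisymm hq (le_of_mul_le_mul_left (?_ : l * (a * b) ≤ l * q) hl)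
  have i3 := mul_le_mul_of_nonneg_left i2 (mul_pos hl ha).le
  nlinarith

end Balance

/-! ### Scaling in the Sobolev class. -/

section Sobolev

variable {r : ℕ} {f : ℝ → ℝ}

theorem MemSobolev.const_mul {a b : ℝ} (hf : MemSobolev r a b f) (C : ℝ) :
    MemSobolev r a b (fun x => C * f x) := by
  have h : ∀ m, iteratedDerivWithin m (fun x => C * f x) (Icc a b) =
      fun x => C * iteratedDerivWithin m f (Icc a b) x :=
    fun m => funext fun x => iteratedDerivWithin_const_mul_field C f
  refine ⟨contDiffOn_const.mul hf.contDiffOn, ?_, ?_⟩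
  · rw [h]; exact hf.absolutelyContinuous.const_mul C
  · rw [h]; exact hf.memLp.const_mul C

theorem MemSobolev.exists_L2 (hf : MemSobolev r (-1) 1 f) : ∃ F G : L2,
    F =ᵐ[volI] f ∧ G =ᵐ[volI] iteratedDerivWithin r f (Icc (-1) 1) :=
  ⟨(memLp_of_continuousOn hf.contDiffOn.continuousOn).toLp _, hf.memLp.toLp _,
    MemLp.coeFn_toLp _, MemLp.coeFn_toLp _⟩

theorem l2norm_const_mul (C : ℝ) (f : ℝ → ℝ) : l2norm (fun x => C * f x) = |C| * l2norm f := by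
  simp only [l2norm, abs_mul, mul_pow]
  rw [intervalIntegral.integral_const_mul, Real.sqrt_mul (by positivity),
    Real.sqrt_sq (abs_nonneg C)]

theorem l2norm_nonneg (f : ℝ → ℝ) : 0 ≤ l2norm f := Real.sqrt_nonneg _

theorem derivAt_const_mul (k : ℕ) (t C : ℝ) (f : ℝ → ℝ) :
    derivAt k t (fun x => C * f x) = C * derivAt k t f :=
  iteratedDerivWithin_const_mul_field C f

theorem classW_neg (hf : f ∈ classW r) : (fun x => -1 * f x) ∈ classW r := by
  refine ⟨hf.1.const_mul _, ?_⟩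
  have h : iteratedDerivWithin r (fun x => -1 * f x) (Icc (-1) 1) =
      fun x => -1 * iteratedDerivWithin r f (Icc (-1) 1) x :=
    funext fun x => iteratedDerivWithin_const_mul_field (-1) f
  rw [h, l2norm_const_mul]
  simpa using hf.2

end Sobolev

/-! ### Lower bounds on the solutions from test polynomials. -/

section Estimates

variable {r k : ℕ} [NeZero r] {t lam : ℝ} {v : Fin (2 * r) → ℝ}

theorem abs_inner_sub_le (r : ℕ) {F G U D : L2} {α β : ℝ} (hF : ‖F‖ ≤ α) (hG : ‖G‖ ≤ β) :
    |inner ℝ F D - (-1) ^ r * inner ℝ G U| ≤ α * ‖D‖ + β * ‖U‖ := by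
  refine (abs_sub _ _).trans (add_le_add ?_ ?_)
  · exact (abs_real_inner_le_norm F D).trans (mul_le_mul_of_nonneg_right hF (norm_nonneg _))
  · rw [abs_mul, abs_pow, abs_neg, abs_one, one_pow, one_mul]
    exact (abs_real_inner_le_norm G U).trans (mul_le_mul_of_nonneg_right hG (norm_nonneg _))

theorem abs_derivAt_le (hk : k < r) (ht : t ∈ Ioo (-1 : ℝ) 1) (hv : IsData r k t lam v)
    {f : ℝ → ℝ} (hf : MemSobolev r (-1) 1 f) :
    |derivAt k t f| ≤ l2norm f * ‖solL2 r k t lam v r‖ +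
      l2norm (iteratedDerivWithin r f (Icc (-1) 1)) * ‖solL2 r k t lam v 0‖ := by
  obtain ⟨F, G, hF, hG⟩ := hf.exists_L2
  rw [derivAt_eq_inner hk ht hv hf hF hG, l2norm_eq_norm hF, l2norm_eq_norm hG]
  exact abs_inner_sub_le r le_rfl le_rfl

theorem iteratedDeriv_polynomial (p : Polynomial ℝ) (s : ℕ) :
    iteratedDeriv s (fun x => p.eval x) = fun x => (Polynomial.derivative^[s] p).eval x := by
  induction s with
  | zero => simp
  | succ s ih =>
    ext x
    rw [iteratedDeriv_succ, ih, Polynomial.deriv, Function.iterate_succ_apply']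

theorem iteratedDeriv_polynomial_sub (p : Polynomial ℝ) (s : ℕ) (t x : ℝ) :
    iteratedDeriv s (fun x => p.eval (x - t)) x = (Polynomial.derivative^[s] p).eval (x - t) := by
  rw [iteratedDeriv_comp_sub_const s (fun x => p.eval x) t, iteratedDeriv_polynomial]

theorem contDiff_polynomial_sub (p : Polynomial ℝ) (t : ℝ) :
    ContDiff ℝ ∞ (fun x => p.eval (x - t)) :=
  (by simpa using p.contDiff_aeval (𝕜 := ℝ) ∞ : ContDiff ℝ ∞ fun x => p.eval x).comp
    (contDiff_id.sub contDiff_const)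

theorem derivAt_polynomial_sub (p : Polynomial ℝ) (k : ℕ) (ht : t ∈ Ioo (-1 : ℝ) 1) :
    derivAt k t (fun x => p.eval (x - t)) = k.factorial * p.coeff k := by
  rw [derivAt, iteratedDerivWithin_Icc_of_mem_Ioo _ _ ht, iteratedDeriv_polynomial_sub, sub_self,
    ← Polynomial.coeff_zero_eq_eval_zero, Polynomial.coeff_iterate_derivative]
  simp [Nat.descFactorial_self]

/-- Test with `(x - t) ^ k`: its `r`-th derivative vanishes, so only the term with `u⁽ʳ⁾` can
account for the value `k!`. -/
theorem exists_le_norm_solL2 (hk : k < r) (ht : t ∈ Ioo (-1 : ℝ) 1) : ∃ c, 0 < c ∧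
    ∀ lam v, IsData r k t lam v → c ≤ ‖solL2 r k t lam v r‖ := by
  set p : Polynomial ℝ := Polynomial.X ^ k
  set f : ℝ → ℝ := fun x => p.eval (x - t) with hf
  have hfc : ContDiff ℝ ∞ f := contDiff_polynomial_sub p t
  have hA := l2norm_nonneg f
  refine ⟨k.factorial / (l2norm f + 1), by positivity, fun lam v hv => ?_⟩
  have h := abs_derivAt_le hk ht hv (MemSobolev.of_contDiff (by norm_num) hfc r)
  have hz : l2norm (iteratedDerivWithin r f (Icc (-1) 1)) = 0 := by
    have : ∀ x ∈ uIcc (-1 : ℝ) 1, |iteratedDerivWithin r f (Icc (-1) 1) x| ^ 2 = 0 := by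
      intro x hx
      rw [uIcc_of_le (by norm_num)] at hx
      rw [iteratedDerivWithin_Icc_eq_iteratedDeriv (by norm_num) (hfc.natCast_of_top r) hx,
        iteratedDeriv_polynomial_sub, Polynomial.iterate_derivative_eq_zero (by simpa [p] using hk)]
      simp
    rw [l2norm, intervalIntegral.integral_congr this]
    simp
  rw [derivAt_polynomial_sub p k ht, hz, zero_mul, add_zero] at h
  simp only [p, Polynomial.coeff_X_pow_self, mul_one, Nat.abs_cast] at h
  rw [div_le_iff₀ (by positivity)]
  nlinarith [norm_nonneg (solL2 r k t lam v r)]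

/-- A polynomial with prescribed derivative of order `k` at `0` and small values elsewhere. -/
noncomputable def peak (k m : ℕ) : Polynomial ℝ :=
  Polynomial.X ^ k * (1 - Polynomial.C (1 / 4) * Polynomial.X ^ 2) ^ m

theorem eval_peak (k m : ℕ) (x : ℝ) : (peak k m).eval x = x ^ k * (1 - x ^ 2 / 4) ^ m := by
  simp [peak]
  left; ring

theorem coeff_peak (k m : ℕ) : (peak k m).coeff k = 1 := by
  rw [peak, Polynomial.coeff_X_pow_mul', if_pos le_rfl, Nat.sub_self,
    Polynomial.coeff_zero_eq_eval_zero]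
  simp

/-- Dominated convergence: `|x - t| < 2` on `[-1,1]`, so `1 - (x - t)²/4` lies in `(0, 1]` and
equals `1` only at `t`. -/
theorem tendsto_l2norm_peak (k : ℕ) (ht : t ∈ Ioo (-1 : ℝ) 1) :
    Tendsto (fun m => l2norm (fun x => (peak k m).eval (x - t))) atTop (𝓝 0) := by
  have hint : Tendsto (fun m => ∫ x in (-1 : ℝ)..1, |(peak k m).eval (x - t)| ^ 2) atTop
      (𝓝 (∫ x in (-1 : ℝ)..1, 0)) := by
    refine intervalIntegral.tendsto_integral_filter_of_dominated_convergence
      (fun x => ((x - t) ^ k) ^ 2) (.of_forall fun m => ?_) (.of_forall fun m => ?_) ?_ ?_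
    · exact Continuous.aestronglyMeasurable
        (((peak k m).continuous.comp (continuous_id.sub continuous_const)).abs.pow 2)
    · refine ae_of_all _ fun x hx => ?_
      rw [uIoc_of_le (by norm_num)] at hx
      rw [eval_peak, Real.norm_eq_abs, abs_pow, abs_abs, sq_abs, mul_pow]
      have h1 : (x - t) ^ 2 ≤ 4 := by nlinarith [hx.1, hx.2, ht.1, ht.2]
      have h2 : (1 - (x - t) ^ 2 / 4) ^ m ≤ 1 :=
        pow_le_one₀ (by linarith) (by linarith [sq_nonneg (x - t)])
      have h3 : 0 ≤ (1 - (x - t) ^ 2 / 4) ^ m := pow_nonneg (by linarith) m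
      exact mul_le_of_le_one_right (sq_nonneg _) (pow_le_one₀ h3 h2)
    · exact Continuous.intervalIntegrable (by fun_prop) _ _
    · have : ∀ᵐ x : ℝ, x ≠ t := by simp [ae_iff, measure_singleton]
      filter_upwards [this] with x hxt hx
      rw [uIoc_of_le (by norm_num)] at hx
      have h1 : (x - t) ^ 2 < 4 := by nlinarith [hx.1, hx.2, ht.1, ht.2]
      have h2 : 0 < (x - t) ^ 2 := by have := sub_ne_zero.2 hxt; positivity
      have h3 := (tendsto_pow_atTop_nhds_zero_of_lt_one (r := 1 - (x - t) ^ 2 / 4)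
        (by linarith) (by linarith)).const_mul ((x - t) ^ k)
      have h4 := (h3.abs).pow 2
      simp only [eval_peak]
      simpa using h4
  have := (Real.continuous_sqrt.tendsto _).comp hint
  simpa [l2norm, Function.comp_def] using this

/-- Test with a peak of norm below `ε`; `M` is the norm of its `r`-th derivative, hence independent
of `lam`. -/
theorem exists_le_mul_norm_solL2 (hk : k < r) (ht : t ∈ Ioo (-1 : ℝ) 1) {ε : ℝ} (hε : 0 < ε) :
    ∃ M, ∀ lam v, IsData r k t lam v →
      1 ≤ ε * ‖solL2 r k t lam v r‖ + M * ‖solL2 r k t lam v 0‖ := by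
  obtain ⟨m, hm⟩ := ((tendsto_l2norm_peak k ht).eventually (gt_mem_nhds hε)).exists
  set f : ℝ → ℝ := fun x => (peak k m).eval (x - t) with hf
  refine ⟨l2norm (iteratedDerivWithin r f (Icc (-1) 1)), fun lam v hv => ?_⟩
  have h := abs_derivAt_le hk ht hv
    (MemSobolev.of_contDiff (by norm_num) (contDiff_polynomial_sub (peak k m) t) r)
  rw [derivAt_polynomial_sub _ k ht, coeff_peak, mul_one, Nat.abs_cast] at h
  have h1 : (1 : ℝ) ≤ k.factorial := by exact_mod_cast Nat.one_le_iff_ne_zero.2 k.factorial_ne_zero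
  have h2 := mul_le_mul_of_nonneg_right hm.le (norm_nonneg (solL2 r k t lam v r))
  linarith

end Estimates

/-! ### The extremal function and the reproducing identity. -/

section Extremal

variable {r k : ℕ} [NeZero r] {t lam : ℝ} {v : Fin (2 * r) → ℝ}

/-- The `r`-th derivative of the solution, extended to `t`. -/
noncomputable def extremal (r k : ℕ) [NeZero r] (t lam : ℝ) (v : Fin (2 * r) → ℝ) : ℝ → ℝ :=
  glue t (iteratedDeriv r (branch r t lam v)) (iteratedDeriv r (branch r t lam (v + jumpVec r k)))

theorem iteratedDeriv_iteratedDeriv (s m : ℕ) (f : ℝ → ℝ) :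
    iteratedDeriv s (iteratedDeriv m f) = iteratedDeriv (s + m) f := by
  simp only [iteratedDeriv_eq_iterate, Function.iterate_add_apply]

/-- The only jump has order `r - k - 1 < r`, so the derivatives of orders `r, …, 2r - 1` match at
`t`. -/
theorem memSobolev_extremal (r k : ℕ) [NeZero r] (t lam : ℝ) (v : Fin (2 * r) → ℝ) :
    MemSobolev r (-1) 1 (extremal r k t lam v) := by
  have hr : 0 < r := Nat.pos_of_ne_zero (NeZero.ne r)
  refine memSobolev_glue hr (contDiff_iteratedDeriv (contDiff_flow _) r)
    (contDiff_iteratedDeriv (contDiff_flow _) r) fun s hs => ?_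
  rw [iteratedDeriv_iteratedDeriv, iteratedDeriv_iteratedDeriv, iteratedDeriv_flow_self _ (by omega),
    iteratedDeriv_flow_self _ (by omega)]
  have : s + r ≠ r - k - 1 := by omega
  simp [jumpVec, this]

theorem iteratedDerivWithin_extremal_ae (r k : ℕ) [NeZero r] (t lam : ℝ) (v : Fin (2 * r) → ℝ) :
    (((-(-1) ^ r * lam) • solL2 r k t lam v 0 : L2) : ℝ → ℝ) =ᵐ[volI]
      iteratedDerivWithin r (extremal r k t lam v) (Icc (-1) 1) := by
  filter_upwards [Lp.coeFn_smul (-(-1) ^ r * lam) (solL2 r k t lam v 0), solL2_ae r k t lam v 0,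
    iteratedDerivWithin_glue_ae t (iteratedDeriv r (branch r t lam v))
      (iteratedDeriv r (branch r t lam (v + jumpVec r k))) r] with x h1 h2 h3
  rw [h1, Pi.smul_apply, h2, extremal, h3]
  simp only [iteratedDeriv_iteratedDeriv, ← two_mul, glue, iteratedDeriv_zero, smul_eq_mul]
  split_ifs <;> rw [iteratedDeriv_order_flow]

/-- The representation may use any parameter `m`, unrelated to `lam`; the left side does not see
`m`. -/
theorem derivAt_extremal (hk : k < r) (ht : t ∈ Ioo (-1 : ℝ) 1) (v : Fin (2 * r) → ℝ) {m : ℝ}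
    {w : Fin (2 * r) → ℝ} (hw : IsData r k t m w) :
    derivAt k t (extremal r k t lam v) = inner ℝ (solL2 r k t lam v r) (solL2 r k t m w r) +
      lam * inner ℝ (solL2 r k t lam v 0) (solL2 r k t m w 0) := by
  rw [derivAt_eq_inner hk ht hw (memSobolev_extremal r k t lam v) (solL2_ae r k t lam v r)
    (iteratedDerivWithin_extremal_ae r k t lam v), real_inner_smul_left]
  have hsq : ((-1 : ℝ) ^ r) * (-1) ^ r = 1 := by rw [← mul_pow]; simp
  linear_combination lam * inner ℝ (solL2 r k t lam v 0) (solL2 r k t m w 0) * hsq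

/-- Differentiating `n` times multiplies one side by `c` and the other by `c'`. -/
theorem eq_of_eqOn_smul_flow {n : ℕ} [NeZero n] {c c' s a b : ℝ} {v w : Fin n → ℝ}
    (h : EqOn (flow n c t v) (fun x => s * flow n c' t w x) (Ioo a b)) (hc : c ≠ c') :
    EqOn (flow n c t v) 0 (Ioo a b) := by
  intro x hx
  have h1 := iteratedDeriv_eqOn_of_eqOn h n hx
  rw [iteratedDeriv_order_flow, iteratedDeriv_const_mul_field, iteratedDeriv_order_flow] at h1
  have h2 := h hx
  simp only at h2
  have h3 : (c - c') * flow n c t v x = 0 := by linear_combination h1 - c' * h2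
  exact (mul_eq_zero.1 h3).resolve_left (sub_ne_zero.2 hc)

theorem glue_eqOn_of_ae {φ ψ φ' ψ' : ℝ → ℝ} (ht : t ∈ Ioo (-1 : ℝ) 1) (hφ : Continuous φ)
    (hψ : Continuous ψ) (hφ' : Continuous φ') (hψ' : Continuous ψ')
    (h : glue t φ ψ =ᵐ[volI] glue t φ' ψ') : EqOn φ φ' (Ioo (-1) t) ∧ EqOn ψ ψ' (Ioo t 1) := by
  constructor
  · have h1 := ae_restrict_of_ae_restrict_of_subset
      ((Ioo_subset_Ioo_right ht.2.le).trans Ioo_subset_Icc_self : Ioo (-1) t ⊆ Icc (-1 : ℝ) 1) h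
    refine Measure.eqOn_open_of_ae_eq (μ := volume) ?_ isOpen_Ioo hφ.continuousOn hφ'.continuousOn
    filter_upwards [h1, ae_restrict_mem measurableSet_Ioo] with x hx hxm
    rwa [glue_eqOn_left _ _ _ _ hxm, glue_eqOn_left _ _ _ _ hxm] at hx
  · have h1 := ae_restrict_of_ae_restrict_of_subset
      ((Ioo_subset_Ioo_left ht.1.le).trans Ioo_subset_Icc_self : Ioo t 1 ⊆ Icc (-1 : ℝ) 1) h
    refine Measure.eqOn_open_of_ae_eq (μ := volume) ?_ isOpen_Ioo hψ.continuousOn hψ'.continuousOn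
    filter_upwards [h1, ae_restrict_mem measurableSet_Ioo] with x hx hxm
    rwa [glue_eqOn_right _ _ _ _ hxm, glue_eqOn_right _ _ _ _ hxm] at hx

/-- Proportional nonzero solutions belong to the same parameter. -/
theorem eq_of_solL2_eq_smul (ht : t ∈ Ioo (-1 : ℝ) 1) {m s : ℝ} {v w : Fin (2 * r) → ℝ}
    (h : solL2 r k t lam v 0 = s • solL2 r k t m w 0) (h0 : solL2 r k t lam v 0 ≠ 0) :
    lam = m := by
  by_contra hne
  have hc : -(-1 : ℝ) ^ r * lam ≠ -(-1) ^ r * m := fun h =>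
    hne (mul_left_cancel₀ (by simp) h)
  have hae : glue t (branch r t lam v) (branch r t lam (v + jumpVec r k)) =ᵐ[volI]
      glue t (fun x => s * branch r t m w x) (fun x => s * branch r t m (w + jumpVec r k) x) := by
    have h' : (solL2 r k t lam v 0 : ℝ → ℝ) =ᵐ[volI] (s • solL2 r k t m w 0 : L2) := by rw [h]
    filter_upwards [h', solL2_ae r k t lam v 0, solL2_ae r k t m w 0,
      Lp.coeFn_smul s (solL2 r k t m w 0)] with x h1 h2 h3 h4
    simp only [iteratedDeriv_zero] at h2 h3
    rw [← h2, h1, h4, Pi.smul_apply, h3]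
    simp only [glue, smul_eq_mul]
    split_ifs <;> rfl
  obtain ⟨hl, hr⟩ := glue_eqOn_of_ae ht (contDiff_flow _).continuous (contDiff_flow _).continuous
    (continuous_const.mul (contDiff_flow _).continuous)
    (continuous_const.mul (contDiff_flow _).continuous) hae
  have hl0 := eq_of_eqOn_smul_flow hl hc
  have hr0 := eq_of_eqOn_smul_flow hr hc
  refine h0 ((Lp.eq_zero_iff_ae_eq_zero).2 ?_)
  filter_upwards [solL2_ae r k t lam v 0, ae_mem_Ioo_diff t] with x h1 h2
  rw [h1]
  simp only [iteratedDeriv_zero]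
  rcases h2.2.lt_or_gt with hx | hx
  · rw [glue, if_pos hx]; exact hl0 ⟨h2.1.1, hx⟩
  · rw [glue, if_neg (not_lt.2 hx.le)]; exact hr0 ⟨hx, h2.1.2⟩

end Extremal

/-! ### Lower and upper bounds for optimal recovery. -/

section Recovery

variable {r k : ℕ} [NeZero r] {t lam δ : ℝ} {v : Fin (2 * r) → ℝ}

/-- Both `f` and `-f` are compatible with `y = 0`, and the single number `S 0` misses one of
`±f⁽ᵏ⁾(t)` by at least `|f⁽ᵏ⁾(t)|`. -/
theorem modulus_le_recoveryErrorOf (r k : ℕ) (t δ : ℝ) (S : L2 → ℝ) :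
    modulus r k t δ ≤ recoveryErrorOf r k t δ S := by
  refine iSup₂_le fun f hf => ?_
  have hz : ∀ g : ℝ → ℝ, MemSobolev r (-1) 1 g →
      l2norm (fun x => g x - (0 : L2) x) = l2norm g := by
    intro g hg
    obtain ⟨F, G, hF, -⟩ := hg.exists_L2
    rw [l2norm_eq_norm hF]
    refine l2norm_eq_norm ?_
    filter_upwards [hF, Lp.coeFn_zero ℝ 2 volI] with x h1 h2
    rw [h1, h2]; simp
  have hneg := classW_neg hf.1
  have h1 : ENNReal.ofReal |derivAt k t f - S 0| ≤ recoveryErrorOf r k t δ S :=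
    le_iSup₂_of_le (f := fun (p : (ℝ → ℝ) × L2) _ => ENNReal.ofReal |derivAt k t p.1 - S p.2|)
      (f, 0) ⟨hf.1, by rw [hz f hf.1.1]; exact hf.2⟩ le_rfl
  have h2 : ENNReal.ofReal |derivAt k t (fun x => -1 * f x) - S 0| ≤ recoveryErrorOf r k t δ S :=
    le_iSup₂_of_le (f := fun (p : (ℝ → ℝ) × L2) _ => ENNReal.ofReal |derivAt k t p.1 - S p.2|)
      (fun x => -1 * f x, 0) ⟨hneg, by
        rw [hz _ hneg.1, l2norm_const_mul]
        simpa using hf.2⟩ le_rfl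
  rw [derivAt_const_mul] at h2
  have h3 : |derivAt k t f| ≤ max |derivAt k t f - S 0| |-1 * derivAt k t f - S 0| := by
    rw [le_max_iff]
    by_contra! hcon
    obtain ⟨a, b⟩ := hcon
    rw [abs_lt] at a b
    rcases abs_cases (derivAt k t f) with ⟨h, -⟩ | ⟨h, -⟩ <;> rw [h] at a b <;> 
      linarith [a.1, a.2, b.1, b.2]
  refine (ENNReal.ofReal_le_ofReal h3).trans ?_
  rw [ENNReal.ofReal_max]
  exact max_le h1 h2

/-- By the representation the error is `⟨f - y, u⁽ʳ⁾⟩ - (-1)^r ⟨f⁽ʳ⁾, u⟩`; balance is not needed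
here. -/
theorem recoveryErrorOf_le (hk : k < r) (ht : t ∈ Ioo (-1 : ℝ) 1) (hv : IsData r k t lam v)
    (δ : ℝ) : recoveryErrorOf r k t δ (fun y => inner ℝ y (solL2 r k t lam v r)) ≤
      ENNReal.ofReal (‖solL2 r k t lam v r‖ * δ + ‖solL2 r k t lam v 0‖) := by
  refine iSup₂_le fun p hp => ENNReal.ofReal_le_ofReal ?_
  obtain ⟨f, y⟩ := p
  obtain ⟨⟨hf, hfr⟩, hfy⟩ := hp
  obtain ⟨F, G, hF, hG⟩ := hf.exists_L2
  simp only at hf hfr hfy ⊢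
  rw [l2norm_eq_norm hG] at hfr
  have hFy : ((F - y : L2) : ℝ → ℝ) =ᵐ[volI] fun x => f x - y x := by
    filter_upwards [Lp.coeFn_sub F y, hF] with x h1 h2
    rw [h1, Pi.sub_apply, h2]
  rw [l2norm_eq_norm hFy] at hfy
  have := abs_inner_sub_le r (D := solL2 r k t lam v r) (U := solL2 r k t lam v 0) hfy hfr
  rw [derivAt_eq_inner hk ht hv hf hF hG, sub_right_comm, ← inner_sub_left]
  linarith

theorem le_modulus (hk : k < r) (ht : t ∈ Ioo (-1 : ℝ) 1) (hv : IsData r k t lam v)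
    (hlam : 0 < lam) (hU : solL2 r k t lam v 0 ≠ 0)
    (hbal : δ * lam * ‖solL2 r k t lam v 0‖ = ‖solL2 r k t lam v r‖) :
    ENNReal.ofReal (‖solL2 r k t lam v r‖ * δ + ‖solL2 r k t lam v 0‖) ≤ modulus r k t δ := by
  have ha : 0 < ‖solL2 r k t lam v 0‖ := norm_pos_iff.2 hU
  set a := ‖solL2 r k t lam v 0‖ with ha'
  set b := ‖solL2 r k t lam v r‖ with hb'
  -- Normalizes the `r`-th derivative to norm `1`; balance then makes the norm of the function
  -- exactly `δ`.
  set C := (lam * a)⁻¹ with hC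
  have hC0 : 0 < C := by positivity
  have hCa : C * (lam * a) = 1 := inv_mul_cancel₀ (by positivity)
  have hmem : (fun x => C * extremal r k t lam v x) ∈
      {f : ℝ → ℝ | f ∈ classW r ∧ l2norm f ≤ δ} := by
    refine ⟨⟨(memSobolev_extremal r k t lam v).const_mul C, ?_⟩, ?_⟩
    · have h : iteratedDerivWithin r (fun x => C * extremal r k t lam v x) (Icc (-1) 1) =
          fun x => C * iteratedDerivWithin r (extremal r k t lam v) (Icc (-1) 1) x :=
        funext fun x => iteratedDerivWithin_const_mul_field C _
      rw [h, l2norm_const_mul, l2norm_eq_norm (iteratedDerivWithin_extremal_ae r k t lam v),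
        norm_smul, abs_of_pos hC0]
      simp only [norm_mul, norm_neg, norm_pow, norm_one, one_pow, one_mul, Real.norm_eq_abs,
        abs_of_pos hlam]
      exact hCa.le
    · rw [l2norm_const_mul, extremal, l2norm_eq_norm (solL2_ae r k t lam v r), abs_of_pos hC0,
        ← hb', ← hbal]
      exact le_of_eq (by linear_combination δ * hCa)
  have hval : derivAt k t (fun x => C * extremal r k t lam v x) = b * δ + a := by
    rw [derivAt_const_mul, derivAt_extremal hk ht v hv, real_inner_self_eq_norm_sq,
      real_inner_self_eq_norm_sq, ← ha', ← hb']
    linear_combination (a + b * δ) * hCa - C * b * hbal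
  refine le_iSup₂_of_le (f := fun (f : ℝ → ℝ) _ => ENNReal.ofReal |derivAt k t f|) _ hmem ?_
  rw [hval]
  exact ENNReal.ofReal_le_ofReal (le_abs_self _)

theorem solL2_ae_of_eqOn {u : ℝ → ℝ}
    (hl : EqOn u (branch r t lam v) (Ioo (-1) t))
    (hr : EqOn u (branch r t lam (v + jumpVec r k)) (Ioo t 1)) (s : ℕ) :
    solL2 r k t lam v s =ᵐ[volI] iteratedDeriv s u := by
  filter_upwards [solL2_ae r k t lam v s, ae_mem_Ioo_diff t] with x h1 h2
  rw [h1]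
  rcases h2.2.lt_or_gt with hx | hx
  · rw [glue, if_pos hx, iteratedDeriv_eqOn_of_eqOn hl s ⟨h2.1.1, hx⟩]
  · rw [glue, if_neg (not_lt.2 hx.le), iteratedDeriv_eqOn_of_eqOn hr s ⟨hx, h2.1.2⟩]

end Recovery

end LandauKolmogorov

/-! ### Assembly of the theorem. -/

theorem mainTheorem4 (r k : ℕ) (hk : k < r) (t : ℝ) (ht : t ∈ Set.Ioo (-1 : ℝ) 1) :
    -- the boundary value problem is well posed, so that `u_{λ,t}` is meaningful
    (∀ lam : ℝ, 0 ≤ lam → ∃ u : ℝ → ℝ, LandauKolmogorov.IsSolution r k t lam u ∧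
      ∀ v : ℝ → ℝ, LandauKolmogorov.IsSolution r k t lam v →
        Set.EqOn v u (Set.Ioo (-1) t ∪ Set.Ioo t 1)) ∧
    -- for the solutions `u lam = u_{λ,t}`, where `(u lam)^{(r)}` is taken off the point `t`
    ∀ u : ℝ → ℝ → ℝ, (∀ lam : ℝ, 0 ≤ lam → LandauKolmogorov.IsSolution r k t lam (u lam)) →
      ∀ δ : ℝ, 0 < δ → ∃ lam : ℝ, 0 < lam ∧
        δ * lam * LandauKolmogorov.l2norm (u lam) =
          LandauKolmogorov.l2norm (iteratedDeriv r (u lam)) ∧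
        (∀ mu : ℝ, 0 < mu →
          δ * mu * LandauKolmogorov.l2norm (u mu) =
            LandauKolmogorov.l2norm (iteratedDeriv r (u mu)) → mu = lam) ∧
        ∀ R : Set (LandauKolmogorov.L2 → ℝ),
          (R = Set.univ ∨ R = {S : LandauKolmogorov.L2 → ℝ | IsLinearMap ℝ S}) →
          LandauKolmogorov.modulus r k t δ =
            LandauKolmogorov.optimalRecoveryError R r k t δ ∧
          LandauKolmogorov.optimalRecoveryError R r k t δ =
            ENNReal.ofReal (LandauKolmogorov.l2norm (iteratedDeriv r (u lam)) * δ +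
              LandauKolmogorov.l2norm (u lam)) := by
  open LandauKolmogorov in
  have : NeZero r := ⟨by omega⟩
  refine ⟨fun lam hlam => existsUnique_isSolution k ht hlam, fun u hu δ hδ => ?_⟩
  choose! v hv hvl hvr using fun lam hlam => (hu lam hlam).exists_isData ht
  set U : ℝ → L2 := fun l => solL2 r k t l (v l) 0 with hU
  set D : ℝ → L2 := fun l => solL2 r k t l (v l) r with hD
  have hnU : ∀ l, 0 ≤ l → l2norm (u l) = ‖U l‖ := fun l hl => by
    have := solL2_ae_of_eqOn (hvl l hl) (hvr l hl) 0
    rw [iteratedDeriv_zero] at this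
    exact l2norm_eq_norm this
  have hnD : ∀ l, 0 ≤ l → l2norm (iteratedDeriv r (u l)) = ‖D l‖ := fun l hl =>
    l2norm_eq_norm (solL2_ae_of_eqOn (hvl l hl) (hvr l hl) r)
  have hφ : ∀ l m, 0 ≤ l → 0 ≤ m → inner ℝ (D l) (D m) + l * inner ℝ (U l) (U m) =
      derivAt k t (extremal r k t l (v l)) :=
    fun l m _ hm => (derivAt_extremal hk ht (v l) (hv m hm)).symm
  obtain ⟨c, hc, hcD⟩ := exists_le_norm_solL2 hk ht
  have hcD' : ∀ l, 0 ≤ l → c ≤ ‖D l‖ := fun l hl => hcD l (v l) (hv l hl)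
  have htest : ∀ ε, 0 < ε → ∃ M, ∀ l, 0 ≤ l → 1 ≤ ε * ‖D l‖ + M * ‖U l‖ := fun ε hε => by
    obtain ⟨M, hM⟩ := exists_le_mul_norm_solL2 hk ht hε
    exact ⟨M, fun l hl => hM l (v l) (hv l hl)⟩
  have hne : ∀ l, 0 < l → δ * l * ‖U l‖ = ‖D l‖ → U l ≠ 0 := fun l hl h h0 => by
    have := hcD' l hl.le
    rw [h0, norm_zero, mul_zero] at h
    linarith
  obtain ⟨lam, hlam, hbal⟩ := exists_balance hφ hc hcD' htest hδ
  have hU0 := hne lam hlam hbal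
  refine ⟨lam, hlam, ?_, fun mu hmu hmubal => ?_, fun R hR => ?_⟩
  · rw [hnU lam hlam.le, hnD lam hlam.le, hbal]
  · rw [hnU mu hmu.le, hnD mu hmu.le] at hmubal
    have hM0 := hne mu hmu hmubal
    have h := smul_eq_smul_of_balance hφ hmu hlam hM0 hU0 hmubal hbal
    refine eq_of_solL2_eq_smul (s := ‖U lam‖⁻¹ * ‖U mu‖) (w := v lam) ht ?_ hM0
    rw [mul_smul, ← h, smul_smul, inv_mul_cancel₀ (norm_ne_zero_iff.2 hU0), one_smul]
  · rw [hnU lam hlam.le, hnD lam hlam.le]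
    have h1 : modulus r k t δ ≤ optimalRecoveryError R r k t δ :=
      le_iInf₂ fun S _ => modulus_le_recoveryErrorOf r k t δ S
    -- The optimal method is linear, so one chain of inequalities serves both classes.
    have hS : (fun y => inner ℝ y (D lam)) ∈ R := by
      rcases hR with rfl | rfl
      · exact mem_univ _
      · exact ⟨fun x y => inner_add_left _ _ _, fun a x => real_inner_smul_left _ _ _⟩
    have h2 : optimalRecoveryError R r k t δ ≤ ENNReal.ofReal (‖D lam‖ * δ + ‖U lam‖) :=
      (iInf₂_le _ hS).trans (recoveryErrorOf_le hk ht (hv lam hlam.le) δ)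
    have h3 : ENNReal.ofReal (‖D lam‖ * δ + ‖U lam‖) ≤ modulus r k t δ :=
      le_modulus hk ht (hv lam hlam.le) hlam hU0 hbal
    exact ⟨le_antisymm h1 (h2.trans h3), le_antisymm h2 (h3.trans h1)⟩
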